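/- Let $\mathbf k$ be a field and $\Omega$ a set. All operads are reduced symmetric $\mathbf k$-linear operads; $\mathcal F(M)$ denotes the free operad on an $\mathbb S$-module $M$, $\mathcal P(M,S)=\mathcal F(M)/(S)$, and for binary operations $\mu,\nu$ put $$(\mu\circ_{\rm I}\nu)(x,y,z)=\mu(\nu(x,y),z),\quad (\mu\circ_{\rm II}\nu)(x,y,z)=\mu(\nu(y,z),x),\quad (\mu\circ_{\rm III}\nu)(x,y,z)=\mu(\nu(z,x),y).$$ *The operad of multi-differential algebras.* Let $\mathcal D_\Omega=\mathcal P(W,S)$ be the operad of commutative associative algebras with pairwise commuting derivations indexed by $\Omega$: $W$ has the unary generators $\partial_\omega$ ($\omega\in\Omega$) and one binary generator $\mu$ with $\mu':=\mu^{(12)}=\mu$, and $S$ consists of $\mu(\mu\otimes\mathrm{id})-\mu(\mathrm{id}\otimes\mu)$, $\mu-\mu^{(12)}$, $\partial_\omega\mu-\mu(\mathrm{id}\otimes\partial_\omega)-\mu(\partial_\omega\otimes\mathrm{id})$ and $\partial_\alpha\partial_\beta-\partial_\beta\partial_\alpha$ ($\omega,\alpha,\beta\in\Omega$). *The pre-induced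 operad.* Let $\mathcal Q=\mathcal P(W,S)$, where $W$ has unary generators $\omega$ (not counting the identity operation) and binary generators $\theta$ forming a basis of $W_2$ that is permuted by $\theta\mapsto\theta'=\theta^{(12)}$. Let $W^{\rm pre}$ be the binary $\mathbb S$-module with basis $\{\prec_{\omega,\theta},\succ_{\omega,\theta}\}$, $\prec_{\omega,\theta}^{(12)}=\succ_{\omega,\theta'}$, $\succ_{\omega,\theta}^{(12)}=\prec_{\omega,\theta'}$, and let $\Phi_{\mathcal Q}:\mathcal F(W^{\rm pre})\to\mathcal Q$ be the morphism of operads with $\prec_{\omega,\theta}\mapsto\theta(\mathrm{id}\otimes\omega)$ and $\succ_{\omega,\theta}\mapsto\theta(\omega\otimes\mathrm{id})$. The pre-induced operad of $\mathcal Q$ is $\mathcal F(W^{\rm pre})/(\ker\Phi_{\mathcal Q}\cap\mathcal F(W^{\rm pre})(3))$. *The operad of multi-Novikov algebras.* Let $V$ be the $S_2$-module with basis $\{\rhd_\omega,\rhd'_\omega\mid\omega\in\Omega\}$ and $\rhd_\omega^{(12)}=\rhd'_\omega$, let $3V^{\otimes2}=(V\circ_{\rm I}V)\oplus(V\circ_{\rm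 II}V)\oplus(V\circ_{\rm III}V)=\mathcal F(V)(3)$, and let $R_\Omega\subseteq\mathcal F(V)(3)$ be the $\mathbf kS_3$-submodule generated by $$\rhd_\beta\circ_{\rm I}\rhd_\alpha-\rhd'_\alpha\circ_{\rm II}\rhd_\beta-\rhd_\beta\circ_{\rm I}\rhd'_\alpha+\rhd'_\alpha\circ_{\rm III}\rhd'_\beta,$$ $$\rhd_\beta\circ_{\rm I}\rhd_\alpha-\rhd'_\alpha\circ_{\rm II}\rhd_\beta-\rhd_\alpha\circ_{\rm I}\rhd_\beta+\rhd'_\beta\circ_{\rm II}\rhd_\alpha,$$ $$\rhd_\beta\circ_{\rm I}\rhd_\alpha-\rhd_\alpha\circ_{\rm III}\rhd'_\beta\qquad(\alpha,\beta\in\Omega),$$ that is, by the identities $$(x\rhd_\alpha y)\rhd_\beta z-x\rhd_\alpha(y\rhd_\beta z)=(y\rhd_\alpha x)\rhd_\beta z-y\rhd_\alpha(x\rhd_\beta z),$$ $$(x\rhd_\alpha y)\rhd_\beta z-x\rhd_\alpha(y\rhd_\beta z)=(x\rhd_\beta y)\rhd_\alpha z-x\rhd_\beta(y\rhd_\alpha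 z),$$ $$(x\rhd_\alpha y)\rhd_\beta z=(x\rhd_\beta z)\rhd_\alpha y.$$ Let $\mathcal N_\Omega=\mathcal F(V)/(R_\Omega)$. **Theorem.** The operad $\mathcal N_\Omega$ is the pre-induced operad of $\mathcal D_\Omega$: there is an isomorphism of operads from $\mathcal N_\Omega$ to the pre-induced operad of $\mathcal D_\Omega$ with $\rhd_\omega\mapsto\prec_{\omega,\mu}$ and $\rhd'_\omega\mapsto\succ_{\omega,\mu}$ for all $\omega\in\Omega$. More precisely, there is a morphism of operads $$\Phi:\mathcal F(V)\to\mathcal D_\Omega,\qquad \rhd_\omega\mapsto\mu(\mathrm{id}\otimes\partial_\omega),\quad \rhd'_\omega\mapsto\mu'(\partial_\omega\otimes\mathrm{id})\qquad(\omega\in\Omega),$$ and every such morphism satisfies $\ker\Phi\cap 3V^{\otimes2}=R_\Omega$. -/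

import Mathlib

open Equiv

universe u v w w' w''

/-! ### Slots of a partial composition

For `m + n = l + 1` and `i : Fin m` (indices start at `0`), the `l` inputs of `μ ∘ᵢ ν` are the inputs
of `μ` other than `i`, together with the block `{i, …, i + n - 1}` of the inputs of `ν`. -/

namespace Operad

/-- The position in `μ ∘ᵢ ν` of the input `j ≠ i` of `μ`. -/
def outer {m n l : ℕ} (h : m + n = l + 1) (i j : Fin m) (hj : j ≠ i) : Fin l :=
  ⟨if (j : ℕ) < i then j else j + n - 1, by
    have := Fin.val_ne_of_ne hj
    split_ifs <;> omega⟩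

/-- The position in `μ ∘ᵢ ν` of the input `b` of `ν`. -/
def inner {m n l : ℕ} (h : m + n = l + 1) (i : Fin m) (b : Fin n) : Fin l :=
  ⟨i + b, by omega⟩

theorem outer_val {m n l : ℕ} (h : m + n = l + 1) (i j : Fin m) (hj : j ≠ i) :
    (outer h i j hj : ℕ) = if (j : ℕ) < i then (j : ℕ) else j + n - 1 := rfl

theorem inner_val {m n l : ℕ} (h : m + n = l + 1) (i : Fin m) (b : Fin n) :
    (inner h i b : ℕ) = i + b := rfl

def slotFun {m n l : ℕ} (h : m + n = l + 1) (i : Fin m) : {j : Fin m // j ≠ i} ⊕ Fin n → Fin l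
  | Sum.inl j => outer h i j.1 j.2
  | Sum.inr b => inner h i b

theorem slotFun_bijective {m n l : ℕ} (h : m + n = l + 1) (i : Fin m) :
    Function.Bijective (slotFun h i) := by
  have hinj : Function.Injective (slotFun h i) := by
    rintro (⟨a, ha⟩ | a) (⟨b, hb⟩ | b) hab <;>
      have hab' := congrArg Fin.val hab <;>
      simp only [slotFun, outer_val, inner_val] at hab'
    · have h1 := Fin.val_ne_of_ne ha
      have h2 := Fin.val_ne_of_ne hb
      have : a = b := by
        apply Fin.ext
        split_ifs at hab' <;> omega
      subst this
      rfl
    · have h1 := Fin.val_ne_of_ne ha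
      exfalso
      split_ifs at hab' <;> omega
    · have h1 := Fin.val_ne_of_ne hb
      exfalso
      split_ifs at hab' <;> omega
    · have : a = b := Fin.ext (by omega)
      rw [this]
  refine (Fintype.bijective_iff_injective_and_card _).2 ⟨hinj, ?_⟩
  have hm : 0 < m := i.pos
  simp [Fintype.card_subtype_compl]
  omega

/-- The inputs of `μ ∘ᵢ ν` are those of `μ` other than `i` and those of `ν`. -/
noncomputable def slots {m n l : ℕ} (h : m + n = l + 1) (i : Fin m) :
    {j : Fin m // j ≠ i} ⊕ Fin n ≃ Fin l :=
  Equiv.ofBijective (slotFun h i) (slotFun_bijective h i)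

/-- The permutation `σ'`: it maps the block at `i` to the block at `σ i` in the natural order and is
given by `σ` on the other inputs. -/
noncomputable def outerPerm {m n l : ℕ} (h : m + n = l + 1) (i : Fin m) (σ : Perm (Fin m)) :
    Perm (Fin l) :=
  (slots h i).symm.trans
    ((Equiv.sumCongr (σ.subtypeEquiv (fun _ => not_congr (σ.apply_eq_iff_eq).symm))
      (Equiv.refl (Fin n))).trans (slots h (σ i)))

/-- The permutation `τ'`: it acts by `τ` on the block at `i` and by the identity elsewhere. -/
noncomputable def innerPerm {m n l : ℕ} (h : m + n = l + 1) (i : Fin m) (τ : Perm (Fin n)) :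
    Perm (Fin l) :=
  (slots h i).symm.trans ((Equiv.sumCongr (Equiv.refl _) τ).trans (slots h i))

theorem outerPerm_outer {m n l : ℕ} (h : m + n = l + 1) (i : Fin m) (σ : Perm (Fin m))
    (j : Fin m) (hj : j ≠ i) :
    outerPerm h i σ (outer h i j hj) = outer h (σ i) (σ j) (σ.injective.ne hj) := by
  have : (slots h i).symm (outer h i j hj) = Sum.inl ⟨j, hj⟩ := by
    rw [Equiv.symm_apply_eq]; rfl
  simp only [outerPerm, Equiv.trans_apply, this]
  rfl

theorem outerPerm_inner {m n l : ℕ} (h : m + n = l + 1) (i : Fin m) (σ : Perm (Fin m))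
    (b : Fin n) : outerPerm h i σ (inner h i b) = inner h (σ i) b := by
  have : (slots h i).symm (inner h i b) = Sum.inr b := by
    rw [Equiv.symm_apply_eq]; rfl
  simp only [outerPerm, Equiv.trans_apply, this]
  rfl

theorem innerPerm_outer {m n l : ℕ} (h : m + n = l + 1) (i : Fin m) (τ : Perm (Fin n))
    (j : Fin m) (hj : j ≠ i) : innerPerm h i τ (outer h i j hj) = outer h i j hj := by
  have : (slots h i).symm (outer h i j hj) = Sum.inl ⟨j, hj⟩ := by
    rw [Equiv.symm_apply_eq]; rfl
  simp only [innerPerm, Equiv.trans_apply, this]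
  rfl

theorem innerPerm_inner {m n l : ℕ} (h : m + n = l + 1) (i : Fin m) (τ : Perm (Fin n))
    (b : Fin n) : innerPerm h i τ (inner h i b) = inner h i (τ b) := by
  have : (slots h i).symm (inner h i b) = Sum.inr b := by
    rw [Equiv.symm_apply_eq]; rfl
  simp only [innerPerm, Equiv.trans_apply, this]
  rfl

end Operad

/-! ### Operads, ideals, quotients, morphisms -/

/-- A reduced symmetric `k`-linear operad, in terms of partial compositions: `comp h i μ ν` is
`μ ∘ᵢ ν` (with `i` counted from `0`), and `act` is the right action of the symmetric groups. -/
structure Operad (k : Type u) [CommRing k] where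
  obj : ℕ → Type w
  [addCommGroup : ∀ n, AddCommGroup (obj n)]
  [module : ∀ n, Module k (obj n)]
  act : ∀ {n : ℕ}, Perm (Fin n) → obj n →ₗ[k] obj n
  act_one : ∀ {n : ℕ} (μ : obj n), act 1 μ = μ
  act_mul : ∀ {n : ℕ} (σ τ : Perm (Fin n)) (μ : obj n), act (σ * τ) μ = act τ (act σ μ)
  one : obj 1
  comp : ∀ {m n l : ℕ}, m + n = l + 1 → Fin m → obj m →ₗ[k] obj n →ₗ[k] obj l
  one_comp : ∀ {n : ℕ} (h : 1 + n = n + 1) (ν : obj n), comp h 0 one ν = ν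
  comp_one : ∀ {m : ℕ} (i : Fin m) (μ : obj m), comp (rfl : m + 1 = m + 1) i μ one = μ
  comp_seq : ∀ {l m n a b c : ℕ} (h₁ : l + m = a + 1) (h₂ : a + n = c + 1) (h₃ : m + n = b + 1)
    (h₄ : l + b = c + 1) (i : Fin l) (j : Fin m) (η : obj l) (μ : obj m) (ν : obj n),
    comp h₂ (Operad.inner h₁ i j) (comp h₁ i η μ) ν = comp h₄ i η (comp h₃ j μ ν)
  comp_par : ∀ {l m n a b c : ℕ} (h₁ : l + m = a + 1) (h₂ : a + n = c + 1) (h₃ : l + n = b + 1)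
    (h₄ : b + m = c + 1) (i j : Fin l) (hij : i ≠ j) (η : obj l) (μ : obj m) (ν : obj n),
    comp h₂ (Operad.outer h₁ i j hij.symm) (comp h₁ i η μ) ν =
      comp h₄ (Operad.outer h₃ j i hij) (comp h₃ j η ν) μ
  act_comp : ∀ {m n l : ℕ} (h : m + n = l + 1) (i : Fin m) (σ : Perm (Fin m)) (μ : obj m)
    (ν : obj n), comp h i (act σ μ) ν = act (Operad.outerPerm h i σ) (comp h (σ i) μ ν)
  comp_act : ∀ {m n l : ℕ} (h : m + n = l + 1) (i : Fin m) (τ : Perm (Fin n)) (μ : obj m)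
    (ν : obj n), comp h i μ (act τ ν) = act (Operad.innerPerm h i τ) (comp h i μ ν)
  reduced : Subsingleton (obj 0)

attribute [instance] Operad.addCommGroup Operad.module

namespace Operad

variable {k : Type u} [CommRing k]

/-- `(μ ∘_I ν)(x, y, z) = μ(ν(x, y), z)`. -/
def circI (P : Operad.{u, w} k) (μ ν : P.obj 2) : P.obj 3 :=
  P.comp (rfl : 2 + 2 = 3 + 1) 0 μ ν

/-- `(μ ∘_II ν)(x, y, z) = μ(ν(y, z), x)`; recall that
`(f ^ σ)(x₀, x₁, x₂) = f(x_{σ⁻¹ 0}, x_{σ⁻¹ 1}, x_{σ⁻¹ 2})`, and `finRotate 3` is `0 ↦ 1 ↦ 2 ↦ 0`. -/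
def circII (P : Operad.{u, w} k) (μ ν : P.obj 2) : P.obj 3 :=
  P.act (finRotate 3)⁻¹ (P.circI μ ν)

/-- `(μ ∘_III ν)(x, y, z) = μ(ν(z, x), y)`. -/
def circIII (P : Operad.{u, w} k) (μ ν : P.obj 2) : P.obj 3 :=
  P.act (finRotate 3) (P.circI μ ν)

/-- The space of quadratic elements `V ∘_I V + V ∘_II V + V ∘_III V`, where `V` is the space of
binary operations. -/
def quadraticPart (P : Operad.{u, w} k) : Submodule k (P.obj 3) :=
  Submodule.span k {x | ∃ μ ν : P.obj 2, x = P.circI μ ν ∨ x = P.circII μ ν ∨ x = P.circIII μ ν}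

/-- The `k S_n`-submodule generated by a set of operations of arity `n`. -/
def symSpan (P : Operad.{u, w} k) {n : ℕ} (S : Set (P.obj n)) : Submodule k (P.obj n) :=
  Submodule.span k {x | ∃ σ : Perm (Fin n), ∃ r ∈ S, x = P.act σ r}

/-- An operadic ideal. -/
structure Ideal (P : Operad.{u, w} k) where
  carrier : ∀ n, Submodule k (P.obj n)
  act_mem : ∀ {n : ℕ} (σ : Perm (Fin n)) {μ : P.obj n}, μ ∈ carrier n → P.act σ μ ∈ carrier n
  comp_mem_left : ∀ {m n l : ℕ} (h : m + n = l + 1) (i : Fin m) {μ : P.obj m} (ν : P.obj n),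
    μ ∈ carrier m → P.comp h i μ ν ∈ carrier l
  comp_mem_right : ∀ {m n l : ℕ} (h : m + n = l + 1) (i : Fin m) (μ : P.obj m) {ν : P.obj n},
    ν ∈ carrier n → P.comp h i μ ν ∈ carrier l

/-- The operadic ideal `(S)` generated by a family of sets `S`: the intersection of all ideals that
contain `S`. -/
def idealSpan (P : Operad.{u, w} k) (S : ∀ n, Set (P.obj n)) : P.Ideal where
  carrier n := ⨅ I : {I : P.Ideal // ∀ n, S n ⊆ I.carrier n}, I.1.carrier n
  act_mem σ μ hμ := by
    simp only [Submodule.mem_iInf] at hμ ⊢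
    exact fun I => I.1.act_mem σ (hμ I)
  comp_mem_left h i μ ν hμ := by
    simp only [Submodule.mem_iInf] at hμ ⊢
    exact fun I => I.1.comp_mem_left h i ν (hμ I)
  comp_mem_right h i μ ν hν := by
    simp only [Submodule.mem_iInf] at hν ⊢
    exact fun I => I.1.comp_mem_right h i μ (hν I)

theorem subset_idealSpan (P : Operad.{u, w} k) (S : ∀ n, Set (P.obj n)) (n : ℕ) {x : P.obj n}
    (hx : x ∈ S n) : x ∈ (P.idealSpan S).carrier n := by
  simp only [idealSpan, Submodule.mem_iInf]
  exact fun I => I.2 n hx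

theorem idealSpan_le (P : Operad.{u, w} k) (S : ∀ n, Set (P.obj n)) (I : P.Ideal)
    (hI : ∀ n, S n ⊆ I.carrier n) (n : ℕ) : (P.idealSpan S).carrier n ≤ I.carrier n :=
  iInf_le (fun I : {I : P.Ideal // ∀ n, S n ⊆ I.carrier n} => I.1.carrier n) ⟨I, hI⟩

/-- A set of operations of arity `n`, regarded as a family of sets concentrated in arity `n`. -/
inductive AtArity (P : Operad.{u, w} k) (n : ℕ) (S : Set (P.obj n)) : ∀ m, P.obj m → Prop
  | mk (x : P.obj n) (hx : x ∈ S) : AtArity P n S n x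

/-- The quotient operad `P / I`. -/
def quotient (P : Operad.{u, w} k) (I : P.Ideal) : Operad.{u, w} k where
  obj n := P.obj n ⧸ I.carrier n
  act σ := (I.carrier _).mapQ (I.carrier _) (P.act σ) fun _ hμ => I.act_mem σ hμ
  act_one := by
    rintro n ⟨μ⟩
    exact congrArg (Submodule.mkQ _) (P.act_one μ)
  act_mul := by
    rintro n σ τ ⟨μ⟩
    exact congrArg (Submodule.mkQ _) (P.act_mul σ τ μ)
  one := (I.carrier 1).mkQ P.one
  comp {m n l} h i := (I.carrier m).liftQ
    { toFun := fun μ => (I.carrier n).mapQ (I.carrier l) (P.comp h i μ)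
        fun _ hν => I.comp_mem_right h i μ hν
      map_add' := by
        intro μ μ'
        ext ν
        simp
      map_smul' := by
        intro c μ
        ext ν
        simp } (by
      intro μ hμ
      rw [LinearMap.mem_ker]
      ext ν
      exact (Submodule.Quotient.mk_eq_zero _).2 (I.comp_mem_left h i ν hμ))
  one_comp := by
    rintro n h ⟨ν⟩
    exact congrArg (Submodule.mkQ _) (P.one_comp h ν)
  comp_one := by
    rintro m i ⟨μ⟩
    exact congrArg (Submodule.mkQ _) (P.comp_one i μ)
  comp_seq := by
    rintro l m n a b c h₁ h₂ h₃ h₄ i j ⟨η⟩ ⟨μ⟩ ⟨ν⟩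
    exact congrArg (Submodule.mkQ _) (P.comp_seq h₁ h₂ h₃ h₄ i j η μ ν)
  comp_par := by
    rintro l m n a b c h₁ h₂ h₃ h₄ i j hij ⟨η⟩ ⟨μ⟩ ⟨ν⟩
    exact congrArg (Submodule.mkQ _) (P.comp_par h₁ h₂ h₃ h₄ i j hij η μ ν)
  act_comp := by
    rintro m n l h i σ ⟨μ⟩ ⟨ν⟩
    exact congrArg (Submodule.mkQ _) (P.act_comp h i σ μ ν)
  comp_act := by
    rintro m n l h i τ ⟨μ⟩ ⟨ν⟩
    exact congrArg (Submodule.mkQ _) (P.comp_act h i τ μ ν)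
  reduced := by
    have := P.reduced
    exact ⟨by rintro ⟨a⟩ ⟨b⟩; exact congrArg (Submodule.mkQ _) (Subsingleton.elim a b)⟩

/-- A morphism of operads. -/
structure Hom (P : Operad.{u, w} k) (Q : Operad.{u, w'} k) where
  app : ∀ n, P.obj n →ₗ[k] Q.obj n
  map_act : ∀ {n : ℕ} (σ : Perm (Fin n)) (μ : P.obj n), app n (P.act σ μ) = Q.act σ (app n μ)
  map_one : app 1 P.one = Q.one
  map_comp : ∀ {m n l : ℕ} (h : m + n = l + 1) (i : Fin m) (μ : P.obj m) (ν : P.obj n),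
    app l (P.comp h i μ ν) = Q.comp h i (app m μ) (app n ν)

/-- An isomorphism of operads: a morphism that is bijective in every arity. -/
structure Iso (P : Operad.{u, w} k) (Q : Operad.{u, w'} k) extends Hom P Q where
  bijective : ∀ n, Function.Bijective (app n)

namespace Hom

variable {P : Operad.{u, w} k} {Q : Operad.{u, w'} k} {R : Operad.{u, w''} k}

/-- Composition of morphisms: first `f`, then `g`. -/
def trans (f : Hom P Q) (g : Hom Q R) : Hom P R where
  app n := (g.app n).comp (f.app n)
  map_act σ μ := by simp [f.map_act, g.map_act]
  map_one := by simp [f.map_one, g.map_one]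
  map_comp h i μ ν := by simp [f.map_comp, g.map_comp]

/-- The kernel of a morphism of operads. -/
def ker (f : Hom P Q) : P.Ideal where
  carrier n := LinearMap.ker (f.app n)
  act_mem σ μ hμ := by
    rw [LinearMap.mem_ker] at hμ ⊢
    rw [f.map_act, hμ, map_zero]
  comp_mem_left h i μ ν hμ := by
    rw [LinearMap.mem_ker] at hμ ⊢
    rw [f.map_comp, hμ, map_zero, LinearMap.zero_apply]
  comp_mem_right h i μ ν hν := by
    rw [LinearMap.mem_ker] at hν ⊢
    rw [f.map_comp, hν, map_zero]

/-- The morphism `P / I → Q` induced by a morphism `P → Q` that vanishes on `I`. -/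
def lift (f : Hom P Q) (I : P.Ideal) (hI : ∀ n, I.carrier n ≤ f.ker.carrier n) :
    Hom (P.quotient I) Q where
  app n := (I.carrier n).liftQ (f.app n) (hI n)
  map_act := by
    rintro n σ ⟨μ⟩
    exact f.map_act σ μ
  map_one := f.map_one
  map_comp := by
    rintro m n l h i ⟨μ⟩ ⟨ν⟩
    exact f.map_comp h i μ ν

end Hom

/-- The projection `P → P / I`. -/
def proj (P : Operad.{u, w} k) (I : P.Ideal) : Hom P (P.quotient I) where
  app n := (I.carrier n).mkQ
  map_act _ _ := rfl
  map_one := rfl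
  map_comp _ _ _ _ := rfl

end Operad

/-! ### Free operads on unary and binary generators -/

/-- Generators of a unary-binary operad: a set `un` (a basis of `W₁`, the identity operation not being
counted) and a set `bin` (a basis of the `S₂`-module `W₂`) on which the transposition in `S₂` acts by
the involution `op`, `θ ↦ θ'`. -/
structure UBGens : Type (max (u + 1) (v + 1)) where
  un : Type u
  bin : Type v
  op : bin → bin
  op_op : ∀ θ, op (op θ) = θ

/-- Planar rooted trees (monomials) built from the unary and binary generators, with leaves labelled
by `X`. -/
inductive UBTree (W : UBGens.{u, v}) (X : Type) : Type (max u v)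
  | leaf : X → UBTree W X
  | un : W.un → UBTree W X → UBTree W X
  | bin : W.bin → UBTree W X → UBTree W X → UBTree W X

namespace UBTree

variable {W : UBGens.{u, v}} {X Y Z : Type}

/-- Substitution of trees for the leaves. -/
def bind : UBTree W X → (X → UBTree W Y) → UBTree W Y
  | leaf x, f => f x
  | un ω t, f => un ω (bind t f)
  | bin θ s t, f => bin θ (bind s f) (bind t f)

/-- Relabelling of the leaves. -/
def map (f : X → Y) (t : UBTree W X) : UBTree W Y := t.bind fun x => leaf (f x)

def leaves : UBTree W X → Multiset X
  | leaf x => {x}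
  | un _ t => leaves t
  | bin _ s t => leaves s + leaves t

theorem bind_bind (t : UBTree W X) (f : X → UBTree W Y) (g : Y → UBTree W Z) :
    (t.bind f).bind g = t.bind fun x => (f x).bind g := by
  induction t with
  | leaf x => rfl
  | un ω t ih => simp only [bind, ih]
  | bin θ s t ihs iht => simp only [bind, ihs, iht]

theorem bind_leaf (t : UBTree W X) : t.bind leaf = t := by
  induction t with
  | leaf x => rfl
  | un ω t ih => simp only [bind, ih]
  | bin θ s t ihs iht => simp only [bind, ihs, iht]

theorem leaves_bind (t : UBTree W X) (f : X → UBTree W Y) :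
    (t.bind f).leaves = t.leaves.bind fun x => (f x).leaves := by
  induction t with
  | leaf x => simp [bind, leaves]
  | un ω t ih => simpa only [bind, leaves] using ih
  | bin θ s t ihs iht => simp only [bind, leaves, ihs, iht, Multiset.add_bind]

theorem leaves_map (t : UBTree W X) (f : X → Y) : (t.map f).leaves = t.leaves.map f := by
  rw [map, leaves_bind]
  simp [leaves, Multiset.bind_singleton]

theorem leaves_ne_zero (t : UBTree W X) : t.leaves ≠ 0 := by
  induction t with
  | leaf x => simp [leaves]
  | un ω t ih => exact ih
  | bin θ s t ihs iht => simp [leaves, ihs]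

end UBTree

/-- Tree monomials of arity `n`: every label in `Fin n` occurs at exactly one leaf. -/
def TreeMonomial (W : UBGens.{u, v}) (n : ℕ) : Type (max u v) :=
  {t : UBTree W (Fin n) // t.leaves = Finset.univ.val}

namespace TreeMonomial

theorem perm_inv_apply_self {α : Type*} (σ : Perm α) (x : α) : σ⁻¹ (σ x) = x :=
  σ.symm_apply_apply x

variable {W : UBGens.{u, v}}

def idTree : TreeMonomial W 1 := ⟨UBTree.leaf 0, rfl⟩

/-- `ω(x₀)` -/
def unTree (ω : W.un) : TreeMonomial W 1 := ⟨UBTree.un ω (UBTree.leaf 0), rfl⟩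

/-- `θ(x₀, x₁)` -/
def binTree (θ : W.bin) : TreeMonomial W 2 :=
  ⟨UBTree.bin θ (UBTree.leaf 0) (UBTree.leaf 1), rfl⟩

/-- The right action of permutations: `(t ^ σ)(x₀, x₁, …) = t(x_{σ⁻¹ 0}, x_{σ⁻¹ 1}, …)`. -/
def perm {n : ℕ} (σ : Perm (Fin n)) (t : TreeMonomial W n) : TreeMonomial W n :=
  ⟨t.1.map fun x => σ⁻¹ x, by
    rw [UBTree.leaves_map, t.2]
    exact congrArg Finset.val (Finset.map_univ_equiv σ⁻¹)⟩

/-- The tree substituted at the leaf `x` of `s` when forming `s ∘ᵢ t`. -/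
def graftFun {m n l : ℕ} (h : m + n = l + 1) (i : Fin m) (t : UBTree W (Fin n)) (x : Fin m) :
    UBTree W (Fin l) :=
  if hx : x = i then t.map (Operad.inner h i) else UBTree.leaf (Operad.outer h i x hx)

theorem graftFun_self {m n l : ℕ} (h : m + n = l + 1) (i : Fin m) (t : UBTree W (Fin n)) :
    graftFun h i t i = t.map (Operad.inner h i) := by simp [graftFun]

theorem graftFun_ne {m n l : ℕ} (h : m + n = l + 1) (i : Fin m) (t : UBTree W (Fin n))
    (x : Fin m) (hx : x ≠ i) : graftFun h i t x = UBTree.leaf (Operad.outer h i x hx) := by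
  simp [graftFun, hx]

theorem graftFun_leaves {m n l : ℕ} (h : m + n = l + 1) (i : Fin m) (t : TreeMonomial W n) :
    (Finset.univ.val.bind fun x => (graftFun h i t.1 x).leaves) =
      (Finset.univ : Finset (Fin l)).val := by
  have hself : (graftFun h i t.1 i).leaves = Finset.univ.val.map (Operad.inner h i) := by
    rw [graftFun_self, UBTree.leaves_map, t.2]
  have hne : ∀ x (hx : x ≠ i), (graftFun h i t.1 x).leaves = {Operad.outer h i x hx} := by
    intro x hx
    rw [graftFun_ne h i t.1 x hx]
    rfl
  have hinj := (Operad.slotFun_bijective h i).1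
  refine (Multiset.Nodup.ext ?_ Finset.univ.nodup).2 ?_
  · rw [Multiset.nodup_bind]
    constructor
    · intro x _
      by_cases hx : x = i
      · subst hx
        rw [hself]
        refine Multiset.Nodup.map ?_ Finset.univ.nodup
        intro a b hab
        exact Sum.inr_injective (hinj (a₁ := Sum.inr a) (a₂ := Sum.inr b) hab)
      · rw [hne x hx]
        exact Multiset.nodup_singleton _
    · refine Multiset.Nodup.pairwise ?_ Finset.univ.nodup
      intro x _ y _ hxy
      rw [Function.onFun, Multiset.disjoint_left]
      intro a hax hay
      by_cases hx : x = i
      · subst hx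
        rw [hself, Multiset.mem_map] at hax
        rw [hne y hxy.symm, Multiset.mem_singleton] at hay
        obtain ⟨b, -, hb⟩ := hax
        have := hinj (a₁ := Sum.inr b) (a₂ := Sum.inl ⟨y, hxy.symm⟩) (hb.trans hay)
        cases this
      · rw [hne x hx, Multiset.mem_singleton] at hax
        by_cases hy : y = i
        · subst hy
          rw [hself, Multiset.mem_map] at hay
          obtain ⟨b, -, hb⟩ := hay
          have := hinj (a₁ := Sum.inr b) (a₂ := Sum.inl ⟨x, hx⟩) (hb.trans hax)
          cases this
        · rw [hne y hy, Multiset.mem_singleton] at hay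
          have := hinj (a₁ := Sum.inl ⟨x, hx⟩) (a₂ := Sum.inl ⟨y, hy⟩) (hax.symm.trans hay)
          exact hxy (congrArg Subtype.val (Sum.inl_injective this))
  · intro a
    refine ⟨fun _ => Finset.mem_univ a, fun _ => ?_⟩
    rw [Multiset.mem_bind]
    obtain ⟨⟨x, hx⟩ | b, rfl⟩ := (Operad.slotFun_bijective h i).2 a
    · refine ⟨x, Finset.mem_univ x, ?_⟩
      rw [hne x hx]
      exact Multiset.mem_singleton_self _
    · refine ⟨i, Finset.mem_univ i, ?_⟩
      rw [hself]
      exact Multiset.mem_map_of_mem _ (Finset.mem_univ b)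

/-- `s ∘ᵢ t`: the tree `t` is grafted at the leaf `i` of `s`. -/
def graft {m n l : ℕ} (h : m + n = l + 1) (i : Fin m) (s : TreeMonomial W m)
    (t : TreeMonomial W n) : TreeMonomial W l :=
  ⟨s.1.bind (graftFun h i t.1), by rw [UBTree.leaves_bind, s.2, graftFun_leaves]⟩

theorem perm_one {n : ℕ} (t : TreeMonomial W n) : perm 1 t = t :=
  Subtype.ext (UBTree.bind_leaf t.1)

theorem perm_mul {n : ℕ} (σ τ : Perm (Fin n)) (t : TreeMonomial W n) :
    perm (σ * τ) t = perm τ (perm σ t) := by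
  refine Subtype.ext ?_
  simp only [perm, UBTree.map, UBTree.bind_bind, UBTree.bind, mul_inv_rev, Perm.mul_apply]

theorem id_graft {n : ℕ} (h : 1 + n = n + 1) (t : TreeMonomial W n) :
    graft h 0 idTree t = t := by
  refine Subtype.ext ?_
  simp only [graft, idTree, UBTree.bind, graftFun_self, UBTree.map]
  have : (fun x => UBTree.leaf (Operad.inner h 0 x) : Fin n → UBTree W (Fin n)) =
      UBTree.leaf := by
    funext x
    congr 1
    apply Fin.ext
    simp [Operad.inner_val]
  rw [this, UBTree.bind_leaf]

theorem graft_id {m : ℕ} (i : Fin m) (s : TreeMonomial W m) :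
    graft (rfl : m + 1 = m + 1) i s idTree = s := by
  refine Subtype.ext ?_
  have : graftFun (rfl : m + 1 = m + 1) i (UBTree.leaf 0 : UBTree W (Fin 1)) =
      UBTree.leaf := by
    funext x
    by_cases hx : x = i
    · subst hx
      rw [graftFun_self]
      simp only [UBTree.map, UBTree.bind]
      congr 1
    · rw [graftFun_ne _ _ _ _ hx]
      congr 1
      apply Fin.ext
      rw [Operad.outer_val]
      split_ifs <;> omega
  simp only [graft, idTree, this, UBTree.bind_leaf]

theorem graft_seq {l m n a b c : ℕ} (h₁ : l + m = a + 1) (h₂ : a + n = c + 1)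
    (h₃ : m + n = b + 1) (h₄ : l + b = c + 1) (i : Fin l) (j : Fin m) (η : TreeMonomial W l)
    (μ : TreeMonomial W m) (ν : TreeMonomial W n) :
    graft h₂ (Operad.inner h₁ i j) (graft h₁ i η μ) ν = graft h₄ i η (graft h₃ j μ ν) := by
  refine Subtype.ext ?_
  simp only [graft, UBTree.bind_bind]
  congr 1
  funext x
  by_cases hx : x = i
  · subst hx
    rw [graftFun_self, graftFun_self]
    simp only [UBTree.map, UBTree.bind_bind, UBTree.bind]
    congr 1
    funext y
    by_cases hy : y = j
    · subst hy
      rw [graftFun_self, graftFun_self]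
      simp only [UBTree.map, UBTree.bind_bind, UBTree.bind]
      congr 1
      funext z
      congr 1
      apply Fin.ext
      simp only [Operad.inner_val]
      omega
    · have hy' : Operad.inner h₁ x y ≠ Operad.inner h₁ x j := by
        intro hh
        have := congrArg Fin.val hh
        simp only [Operad.inner_val] at this
        exact hy (Fin.ext (by omega))
      rw [graftFun_ne _ _ _ _ hy', graftFun_ne _ _ _ _ hy]
      simp only [UBTree.bind]
      congr 1
      apply Fin.ext
      have := Fin.val_ne_of_ne hy
      rw [Operad.inner_val, Operad.outer_val, Operad.outer_val, Operad.inner_val,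
        Operad.inner_val]
      split_ifs <;> omega
  · rw [graftFun_ne _ _ _ _ hx, graftFun_ne _ _ _ _ hx]
    have hxi := Fin.val_ne_of_ne hx
    have hx' : Operad.outer h₁ i x hx ≠ Operad.inner h₁ i j := by
      intro hh
      have := congrArg Fin.val hh
      simp only [Operad.inner_val, Operad.outer_val] at this
      split_ifs at this <;> omega
    simp only [UBTree.bind]
    rw [graftFun_ne _ _ _ _ hx']
    congr 1
    apply Fin.ext
    simp only [Operad.inner_val, Operad.outer_val]
    split_ifs <;> omega

theorem graft_par {l m n a b c : ℕ} (h₁ : l + m = a + 1) (h₂ : a + n = c + 1)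
    (h₃ : l + n = b + 1) (h₄ : b + m = c + 1) (i j : Fin l) (hij : i ≠ j) (η : TreeMonomial W l)
    (μ : TreeMonomial W m) (ν : TreeMonomial W n) :
    graft h₂ (Operad.outer h₁ i j hij.symm) (graft h₁ i η μ) ν =
      graft h₄ (Operad.outer h₃ j i hij) (graft h₃ j η ν) μ := by
  refine Subtype.ext ?_
  simp only [graft, UBTree.bind_bind]
  congr 1
  funext x
  have hne := Fin.val_ne_of_ne hij
  by_cases hx : x = i
  · subst hx
    rw [graftFun_self, graftFun_ne _ _ _ _ hij]
    simp only [UBTree.map, UBTree.bind_bind, UBTree.bind]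
    rw [graftFun_self]
    simp only [UBTree.map]
    congr 1
    funext y
    have hy' : Operad.inner h₁ x y ≠ Operad.outer h₁ x j hij.symm := by
      intro hh
      have := congrArg Fin.val hh
      simp only [Operad.inner_val, Operad.outer_val] at this
      split_ifs at this <;> omega
    rw [graftFun_ne _ _ _ _ hy']
    congr 1
    apply Fin.ext
    simp only [Operad.inner_val, Operad.outer_val]
    split_ifs <;> omega
  · by_cases hxj : x = j
    · subst hxj
      rw [graftFun_self, graftFun_ne _ _ _ _ hx]
      simp only [UBTree.map, UBTree.bind_bind, UBTree.bind]
      rw [graftFun_self]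
      simp only [UBTree.map]
      congr 1
      funext y
      have hy' : Operad.inner h₃ x y ≠ Operad.outer h₃ x i hij := by
        intro hh
        have := congrArg Fin.val hh
        simp only [Operad.inner_val, Operad.outer_val] at this
        split_ifs at this <;> omega
      rw [graftFun_ne _ _ _ _ hy']
      congr 1
      apply Fin.ext
      simp only [Operad.inner_val, Operad.outer_val]
      split_ifs <;> omega
    · have h1 := Fin.val_ne_of_ne hx
      have h2 := Fin.val_ne_of_ne hxj
      rw [graftFun_ne _ _ _ _ hx, graftFun_ne _ _ _ _ hxj]
      simp only [UBTree.bind]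
      have e1 : Operad.outer h₁ i x hx ≠ Operad.outer h₁ i j hij.symm := by
        intro hh
        have := congrArg Fin.val hh
        simp only [Operad.outer_val] at this
        split_ifs at this <;> omega
      have e2 : Operad.outer h₃ j x hxj ≠ Operad.outer h₃ j i hij := by
        intro hh
        have := congrArg Fin.val hh
        simp only [Operad.outer_val] at this
        split_ifs at this <;> omega
      rw [graftFun_ne _ _ _ _ e1, graftFun_ne _ _ _ _ e2]
      congr 1
      apply Fin.ext
      simp only [Operad.outer_val]
      split_ifs <;> omega

theorem perm_graft {m n l : ℕ} (h : m + n = l + 1) (i : Fin m) (σ : Perm (Fin m))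
    (μ : TreeMonomial W m) (ν : TreeMonomial W n) :
    graft h i (perm σ μ) ν = perm (Operad.outerPerm h i σ) (graft h (σ i) μ ν) := by
  refine Subtype.ext ?_
  simp only [graft, perm, UBTree.map, UBTree.bind_bind, UBTree.bind]
  congr 1
  funext x
  obtain ⟨y, rfl⟩ := σ.surjective x
  rw [perm_inv_apply_self]
  by_cases hy : y = i
  · subst hy
    rw [graftFun_self, graftFun_self]
    simp only [UBTree.map, UBTree.bind_bind, UBTree.bind]
    congr 1
    funext b
    rw [← Operad.outerPerm_inner, perm_inv_apply_self]
  · rw [graftFun_ne _ _ _ _ hy, graftFun_ne _ _ _ _ (σ.injective.ne hy)]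
    simp only [UBTree.bind]
    rw [← Operad.outerPerm_outer, perm_inv_apply_self]

theorem graft_perm {m n l : ℕ} (h : m + n = l + 1) (i : Fin m) (τ : Perm (Fin n))
    (μ : TreeMonomial W m) (ν : TreeMonomial W n) :
    graft h i μ (perm τ ν) = perm (Operad.innerPerm h i τ) (graft h i μ ν) := by
  refine Subtype.ext ?_
  simp only [graft, perm, UBTree.map, UBTree.bind_bind]
  congr 1
  funext x
  by_cases hx : x = i
  · subst hx
    rw [graftFun_self, graftFun_self]
    simp only [UBTree.map, UBTree.bind_bind, UBTree.bind]
    congr 1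
    funext b
    obtain ⟨b', rfl⟩ := τ.surjective b
    rw [perm_inv_apply_self τ b', ← Operad.innerPerm_inner,
      perm_inv_apply_self (Operad.innerPerm h x τ)]
  · rw [graftFun_ne _ _ _ _ hx, graftFun_ne _ _ _ _ hx]
    simp only [UBTree.bind]
    nth_rewrite 2 [← Operad.innerPerm_outer h i τ x hx]
    rw [perm_inv_apply_self]

end TreeMonomial

/-- The bilinear extension of a map of bases. -/
noncomputable def treeComp (k : Type w) [CommRing k] (W : UBGens.{u, v}) {m n l : ℕ}
    (h : m + n = l + 1) (i : Fin m) :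
    (TreeMonomial W m →₀ k) →ₗ[k] (TreeMonomial W n →₀ k) →ₗ[k] (TreeMonomial W l →₀ k) :=
  Finsupp.linearCombination k fun s => Finsupp.lmapDomain k k (TreeMonomial.graft h i s)

theorem treeComp_single {k : Type w} [CommRing k] {W : UBGens.{u, v}} {m n l : ℕ}
    (h : m + n = l + 1) (i : Fin m) (s : TreeMonomial W m) (t : TreeMonomial W n) (c d : k) :
    treeComp k W h i (Finsupp.single s c) (Finsupp.single t d) =
      Finsupp.single (TreeMonomial.graft h i s t) (c * d) := by
  rw [treeComp, Finsupp.linearCombination_single, LinearMap.smul_apply, Finsupp.lmapDomain_apply,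
    Finsupp.mapDomain_single, Finsupp.smul_single, smul_eq_mul]

/-- The operad of tree monomials: the free operad on the unary generators `ω` and on binary generators
`θ` without symmetry. -/
noncomputable def treeOperad (k : Type w) [CommRing k] (W : UBGens.{u, v}) :
    Operad.{w, max u v w} k where
  obj n := TreeMonomial W n →₀ k
  act σ := Finsupp.lmapDomain k k (TreeMonomial.perm σ)
  act_one μ := by
    induction μ using Finsupp.induction_linear with
    | zero => simp
    | add f g hf hg => rw [map_add, hf, hg]
    | single t c => simp [TreeMonomial.perm_one]
  act_mul σ τ μ := by
    induction μ using Finsupp.induction_linear with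
    | zero => simp
    | add f g hf hg => simp only [map_add, hf, hg]
    | single t c => simp [TreeMonomial.perm_mul]
  one := Finsupp.single TreeMonomial.idTree 1
  comp h i := treeComp k W h i
  one_comp h ν := by
    induction ν using Finsupp.induction_linear with
    | zero => simp
    | add f g hf hg => rw [map_add, hf, hg]
    | single t c => rw [treeComp_single, TreeMonomial.id_graft, one_mul]
  comp_one i μ := by
    induction μ using Finsupp.induction_linear with
    | zero => simp
    | add f g hf hg => rw [map_add, LinearMap.add_apply, hf, hg]
    | single t c => rw [treeComp_single, TreeMonomial.graft_id, mul_one]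
  comp_seq h₁ h₂ h₃ h₄ i j η μ ν := by
    induction η using Finsupp.induction_linear with
    | zero => simp
    | add f g hf hg => simp only [map_add, LinearMap.add_apply, hf, hg]
    | single t c =>
      induction μ using Finsupp.induction_linear with
      | zero => simp
      | add f g hf hg => simp only [map_add, LinearMap.add_apply, hf, hg]
      | single t' c' =>
        induction ν using Finsupp.induction_linear with
        | zero => simp
        | add f g hf hg => simp only [map_add, hf, hg]
        | single t'' c'' => 
          simp only [treeComp_single, TreeMonomial.graft_seq h₁ h₂ h₃ h₄, mul_assoc]
  comp_par h₁ h₂ h₃ h₄ i j hij η μ ν := by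
    induction η using Finsupp.induction_linear with
    | zero => simp
    | add f g hf hg => simp only [map_add, LinearMap.add_apply, hf, hg]
    | single t c =>
      induction μ using Finsupp.induction_linear with
      | zero => simp
      | add f g hf hg => simp only [map_add, LinearMap.add_apply, hf, hg]
      | single t' c' =>
        induction ν using Finsupp.induction_linear with
        | zero => simp
        | add f g hf hg => simp only [map_add, LinearMap.add_apply, hf, hg]
        | single t'' c'' =>
          simp only [treeComp_single, TreeMonomial.graft_par h₁ h₂ h₃ h₄ i j hij]
          rw [mul_right_comm]
  act_comp h i σ μ ν := by
    induction μ using Finsupp.induction_linear with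
    | zero => simp
    | add f g hf hg => simp only [map_add, LinearMap.add_apply, hf, hg]
    | single t c =>
      induction ν using Finsupp.induction_linear with
      | zero => simp
      | add f g hf hg => simp only [map_add, hf, hg]
      | single t' c' =>
        simp only [treeComp_single, Finsupp.lmapDomain_apply, Finsupp.mapDomain_single,
          TreeMonomial.perm_graft]
  comp_act h i τ μ ν := by
    induction μ using Finsupp.induction_linear with
    | zero => simp
    | add f g hf hg => simp only [map_add, LinearMap.add_apply, hf, hg]
    | single t c =>
      induction ν using Finsupp.induction_linear with
      | zero => simp
      | add f g hf hg => simp only [map_add, hf, hg]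
      | single t' c' =>
        simp only [treeComp_single, Finsupp.lmapDomain_apply, Finsupp.mapDomain_single,
          TreeMonomial.graft_perm]
  reduced := by
    have : IsEmpty (TreeMonomial W 0) := ⟨fun t => UBTree.leaves_ne_zero t.1 (by simpa using t.2)⟩
    exact inferInstance

/-- A tree monomial as an operation. -/
noncomputable def treeOp (k : Type w) [CommRing k] {W : UBGens.{u, v}} {n : ℕ}
    (t : TreeMonomial W n) : (treeOperad k W).obj n :=
  Finsupp.single t (1 : k)

theorem act_treeOp (k : Type w) [CommRing k] {W : UBGens.{u, v}} {n : ℕ} (σ : Perm (Fin n))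
    (t : TreeMonomial W n) : (treeOperad k W).act σ (treeOp k t) = treeOp k (t.perm σ) :=
  Finsupp.mapDomain_single

theorem comp_treeOp (k : Type w) [CommRing k] {W : UBGens.{u, v}} {m n l : ℕ}
    (h : m + n = l + 1) (i : Fin m) (s : TreeMonomial W m) (t : TreeMonomial W n) :
    (treeOperad k W).comp h i (treeOp k s) (treeOp k t) = treeOp k (TreeMonomial.graft h i s t) :=
  (treeComp_single h i s t 1 1).trans (by rw [one_mul]; rfl)

/-- The relations `θ ^ (12) = θ'`. -/
inductive SymRel (k : Type w) [CommRing k] (W : UBGens.{u, v}) :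
    ∀ n, (treeOperad k W).obj n → Prop
  | mk (θ : W.bin) : SymRel k W 2
      ((treeOperad k W).act (swap 0 1) (treeOp k (TreeMonomial.binTree θ)) -
        treeOp k (TreeMonomial.binTree (W.op θ)))

/-- The free operad `F(W)` on the `S`-module `W = W₁ ⊕ W₂` with basis the given generators: trees with
leaves labelled bijectively, where at each binary vertex `θ(s, t)` is identified with `θ'(t, s)`. -/
noncomputable def freeOperad (k : Type w) [CommRing k] (W : UBGens.{u, v}) :
    Operad.{w, max u v w} k :=
  (treeOperad k W).quotient ((treeOperad k W).idealSpan (SymRel k W))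

namespace freeOperad

variable (k : Type w) [CommRing k] {W : UBGens.{u, v}}

/-- The class of a tree monomial. -/
noncomputable def ofTree {n : ℕ} (t : TreeMonomial W n) : (freeOperad k W).obj n :=
  ((treeOperad k W).proj ((treeOperad k W).idealSpan (SymRel k W))).app n (treeOp k t)

theorem act_ofTree {n : ℕ} (σ : Perm (Fin n)) (t : TreeMonomial W n) :
    (freeOperad k W).act σ (ofTree k t) = ofTree k (t.perm σ) :=
  congrArg (Submodule.mkQ _) (act_treeOp k σ t)

theorem comp_ofTree {m n l : ℕ} (h : m + n = l + 1) (i : Fin m) (s : TreeMonomial W m)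
    (t : TreeMonomial W n) :
    (freeOperad k W).comp h i (ofTree k s) (ofTree k t) =
      ofTree k (TreeMonomial.graft h i s t) :=
  congrArg (Submodule.mkQ _) (comp_treeOp k h i s t)

/-- The generating unary operation `ω`. -/
noncomputable def un (ω : W.un) : (freeOperad k W).obj 1 := ofTree k (TreeMonomial.unTree ω)

/-- The generating binary operation `θ`. -/
noncomputable def bin (θ : W.bin) : (freeOperad k W).obj 2 := ofTree k (TreeMonomial.binTree θ)

theorem act_bin (θ : W.bin) : (freeOperad k W).act (swap 0 1) (bin k θ) = bin k (W.op θ) := by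
  refine (Submodule.Quotient.eq _).2 ?_
  exact (treeOperad k W).subset_idealSpan (SymRel k W) 2 (SymRel.mk θ)

/-- `(θ ∘_I η)(x₀, x₁, x₂) = θ(η(x₀, x₁), x₂)` -/
theorem circI_bin (θ η : W.bin) : (freeOperad k W).circI (bin k θ) (bin k η) =
    ofTree k ⟨.bin θ (.bin η (.leaf 0) (.leaf 1)) (.leaf 2), rfl⟩ := by
  rw [Operad.circI, bin, bin, comp_ofTree]
  rfl

/-- `(θ ∘_II η)(x₀, x₁, x₂) = θ(η(x₁, x₂), x₀)` -/
theorem circII_bin (θ η : W.bin) : (freeOperad k W).circII (bin k θ) (bin k η) =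
    ofTree k ⟨.bin θ (.bin η (.leaf 1) (.leaf 2)) (.leaf 0),
      (by decide : ({1} + {2} + {0} : Multiset (Fin 3)) = Finset.univ.val)⟩ := by
  refine (congrArg ((freeOperad k W).act _) (circI_bin k θ η)).trans ((act_ofTree k _ _).trans ?_)
  rfl

/-- `(θ ∘_III η)(x₀, x₁, x₂) = θ(η(x₂, x₀), x₁)` -/
theorem circIII_bin (θ η : W.bin) : (freeOperad k W).circIII (bin k θ) (bin k η) =
    ofTree k ⟨.bin θ (.bin η (.leaf 2) (.leaf 0)) (.leaf 1),
      (by decide : ({2} + {0} + {1} : Multiset (Fin 3)) = Finset.univ.val)⟩ := by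
  refine (congrArg ((freeOperad k W).act _) (circI_bin k θ η)).trans ((act_ofTree k _ _).trans ?_)
  rfl

end freeOperad

/-- The operad `P(W, S) = F(W) / (S)`. -/
noncomputable def presentedOperad (k : Type w) [CommRing k] (W : UBGens.{u, v})
    (S : ∀ n, Set ((freeOperad k W).obj n)) : Operad.{w, max u v w} k :=
  (freeOperad k W).quotient ((freeOperad k W).idealSpan S)

/-- The projection `F(W) → P(W, S)`. -/
noncomputable def presentedOperad.proj (k : Type w) [CommRing k] (W : UBGens.{u, v})
    (S : ∀ n, Set ((freeOperad k W).obj n)) : Operad.Hom (freeOperad k W) (presentedOperad k W S) :=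
  (freeOperad k W).proj ((freeOperad k W).idealSpan S)

/-! ### The pre-induced operad -/

/-- The operations `≺_{ω,θ}` and `≻_{ω,θ}`. -/
inductive PreGen (W : UBGens.{u, v}) : Type (max u v)
  | prec : W.un → W.bin → PreGen W
  | succ : W.un → W.bin → PreGen W

/-- The binary generators `≺_{ω,θ}`, `≻_{ω,θ}` with `≺_{ω,θ} ^ (12) = ≻_{ω,θ'}` and
`≻_{ω,θ} ^ (12) = ≺_{ω,θ'}`. -/
def preGens (W : UBGens.{u, v}) : UBGens.{0, max u v} where
  un := Empty
  bin := PreGen W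
  op
    | PreGen.prec ω θ => PreGen.succ ω (W.op θ)
    | PreGen.succ ω θ => PreGen.prec ω (W.op θ)
  op_op := by
    rintro (⟨ω, θ⟩ | ⟨ω, θ⟩) <;> simp [W.op_op]

/-- Replace every `≺_{ω,θ}(s, t)` by `θ(s, ω(t))` and every `≻_{ω,θ}(s, t)` by `θ(ω(s), t)`. -/
def UBTree.pre {W : UBGens.{u, v}} {X : Type} : UBTree (preGens W) X → UBTree W X
  | leaf x => leaf x
  | un ω _ => Empty.elim ω
  | bin (PreGen.prec ω θ) s t => bin θ s.pre (un ω t.pre)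
  | bin (PreGen.succ ω θ) s t => bin θ (un ω s.pre) t.pre

theorem UBTree.leaves_pre {W : UBGens.{u, v}} {X : Type} (t : UBTree (preGens W) X) :
    t.pre.leaves = t.leaves := by
  induction t with
  | leaf x => rfl
  | un ω t ih => exact Empty.elim ω
  | bin g s t ihs iht =>
    rcases g with ⟨ω, θ⟩ | ⟨ω, θ⟩ <;> simp only [pre, leaves, ihs, iht]

theorem UBTree.pre_bind {W : UBGens.{u, v}} {X Y : Type} (t : UBTree (preGens W) X)
    (f : X → UBTree (preGens W) Y) : (t.bind f).pre = t.pre.bind fun x => (f x).pre := by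
  induction t with
  | leaf x => rfl
  | un ω t ih => exact Empty.elim ω
  | bin g s t ihs iht =>
    rcases g with ⟨ω, θ⟩ | ⟨ω, θ⟩ <;> simp only [pre, bind, ihs, iht]

def TreeMonomial.pre {W : UBGens.{u, v}} {n : ℕ} (t : TreeMonomial (preGens W) n) :
    TreeMonomial W n :=
  ⟨t.1.pre, by rw [UBTree.leaves_pre, t.2]⟩

theorem TreeMonomial.pre_perm {W : UBGens.{u, v}} {n : ℕ} (σ : Perm (Fin n))
    (t : TreeMonomial (preGens W) n) : (perm σ t).pre = perm σ t.pre :=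
  Subtype.ext (UBTree.pre_bind t.1 _)

theorem TreeMonomial.pre_graft {W : UBGens.{u, v}} {m n l : ℕ} (h : m + n = l + 1) (i : Fin m)
    (s : TreeMonomial (preGens W) m) (t : TreeMonomial (preGens W) n) :
    (graft h i s t).pre = graft h i s.pre t.pre := by
  refine Subtype.ext ((UBTree.pre_bind s.1 _).trans ?_)
  simp only [graft, pre]
  congr 1
  funext x
  by_cases hx : x = i
  · subst hx
    rw [graftFun_self, graftFun_self]
    exact UBTree.pre_bind t.1 _
  · rw [graftFun_ne _ _ _ _ hx, graftFun_ne _ _ _ _ hx]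
    rfl

noncomputable def treePreHom (k : Type w) [CommRing k] (W : UBGens.{u, v}) :
    Operad.Hom (treeOperad k (preGens W)) (treeOperad k W) where
  app n := Finsupp.lmapDomain k k TreeMonomial.pre
  map_act {n} σ := by
    intro (μ : TreeMonomial (preGens W) n →₀ k)
    change Finsupp.mapDomain _ (Finsupp.mapDomain _ μ) =
      Finsupp.mapDomain _ (Finsupp.mapDomain _ μ)
    rw [← Finsupp.mapDomain_comp, ← Finsupp.mapDomain_comp]
    congr 1
    funext t
    exact TreeMonomial.pre_perm σ t
  map_one := Finsupp.mapDomain_single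
  map_comp {m n l} h i := by
    intro (μ : TreeMonomial (preGens W) m →₀ k) (ν : TreeMonomial (preGens W) n →₀ k)
    change Finsupp.lmapDomain k k TreeMonomial.pre (treeComp k (preGens W) h i μ ν) =
      treeComp k W h i (Finsupp.lmapDomain k k TreeMonomial.pre μ)
        (Finsupp.lmapDomain k k TreeMonomial.pre ν)
    induction μ using Finsupp.induction_linear with
    | zero => simp only [map_zero, LinearMap.zero_apply]
    | add f g hf hg => simp only [map_add, LinearMap.add_apply, hf, hg]
    | single t c =>
      induction ν using Finsupp.induction_linear with
      | zero => simp only [map_zero]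
      | add f g hf hg => simp only [map_add, hf, hg]
      | single t' c' =>
        simp only [treeComp_single, Finsupp.lmapDomain_apply, Finsupp.mapDomain_single,
          TreeMonomial.pre_graft]

theorem treePreHom_treeOp (k : Type w) [CommRing k] (W : UBGens.{u, v}) {n : ℕ}
    (t : TreeMonomial (preGens W) n) :
    (treePreHom k W).app n (treeOp k t) = treeOp k t.pre :=
  Finsupp.mapDomain_single

theorem Operad.outerPerm_unary {m : ℕ} (i : Fin m) (σ : Perm (Fin m)) :
    Operad.outerPerm (rfl : m + 1 = m + 1) i σ = σ := by
  have h1 : ∀ j : Fin m, Operad.inner (rfl : m + 1 = m + 1) j 0 = j := fun j => rfl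
  have h2 : ∀ (i j : Fin m) (hj : j ≠ i), Operad.outer (rfl : m + 1 = m + 1) i j hj = j := by
    intro i j hj
    apply Fin.ext
    rw [Operad.outer_val]
    split_ifs <;> omega
  ext x
  by_cases hx : x = i
  · subst hx
    have := Operad.outerPerm_inner (rfl : m + 1 = m + 1) x σ 0
    rw [h1, h1] at this
    rw [this]
  · have := Operad.outerPerm_outer (rfl : m + 1 = m + 1) i σ x hx
    rw [h2, h2] at this
    rw [this]

theorem freeOperad.comp_bin_un_right (k : Type w) [CommRing k] {W : UBGens.{u, v}} (ω : W.un)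
    (θ : W.bin) :
    (freeOperad k W).comp (rfl : 2 + 1 = 2 + 1) 1 (bin k θ) (un k ω) =
      ofTree k (TreeMonomial.binTree (W := preGens W) (PreGen.prec ω θ)).pre := by
  rw [bin, un, comp_ofTree]
  rfl

theorem freeOperad.comp_bin_un_left (k : Type w) [CommRing k] {W : UBGens.{u, v}} (ω : W.un)
    (θ : W.bin) :
    (freeOperad k W).comp (rfl : 2 + 1 = 2 + 1) 0 (bin k θ) (un k ω) =
      ofTree k (TreeMonomial.binTree (W := preGens W) (PreGen.succ ω θ)).pre := by
  rw [bin, un, comp_ofTree]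
  rfl

theorem freeOperad.act_pre (k : Type w) [CommRing k] {W : UBGens.{u, v}} (g : PreGen W) :
    ofTree k ((TreeMonomial.binTree (W := preGens W) ((preGens W).op g)).pre) =
      (freeOperad k W).act (swap 0 1)
        (ofTree k ((TreeMonomial.binTree (W := preGens W) g).pre)) := by
  rcases g with ⟨ω, θ⟩ | ⟨ω, θ⟩
  · refine (comp_bin_un_left k ω (W.op θ)).symm.trans ?_
    rw [← comp_bin_un_right, ← act_bin, Operad.act_comp, Operad.outerPerm_unary, swap_apply_left]
  · refine (comp_bin_un_right k ω (W.op θ)).symm.trans ?_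
    rw [← comp_bin_un_left, ← act_bin, Operad.act_comp, Operad.outerPerm_unary, swap_apply_right]

/-- The morphism of free operads with `≺_{ω,θ} ↦ θ(id ⊗ ω)` and `≻_{ω,θ} ↦ θ(ω ⊗ id)`. -/
noncomputable def freePreHom (k : Type w) [CommRing k] (W : UBGens.{u, v}) :
    Operad.Hom (freeOperad k (preGens W)) (freeOperad k W) :=
  ((treePreHom k W).trans
    ((treeOperad k W).proj ((treeOperad k W).idealSpan (SymRel k W)))).lift _ (by
      refine Operad.idealSpan_le _ _ _ ?_
      rintro n _ ⟨g⟩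
      refine (map_sub (((treePreHom k W).trans _).app 2) _ _).trans (sub_eq_zero.2 ?_)
      rw [Operad.Hom.map_act]
      refine Eq.trans ?_ (Eq.trans (freeOperad.act_pre k g).symm ?_)
      · refine congrArg ((freeOperad k W).act (swap 0 1)) ?_
        exact congrArg (((treeOperad k W).proj _).app 2) (treePreHom_treeOp k W _)
      · exact (congrArg (((treeOperad k W).proj _).app 2) (treePreHom_treeOp k W _)).symm)

section
variable (k : Type w) [CommRing k] (W : UBGens.{u, v}) (S : ∀ n, Set ((freeOperad k W).obj n))

/-- The pre-induced morphism `Φ : F(V) → P(W, S)`, `≺_{ω,θ} ↦ θ(id ⊗ ω)`, `≻_{ω,θ} ↦ θ(ω ⊗ id)`. -/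
noncomputable def preHom : Operad.Hom (freeOperad k (preGens W)) (presentedOperad k W S) :=
  (freePreHom k W).trans (presentedOperad.proj k W S)

theorem freePreHom_prec (ω : W.un) (θ : W.bin) :
    (freePreHom k W).app 2 (freeOperad.bin k (W := preGens W) (PreGen.prec ω θ)) =
      (freeOperad k W).comp (rfl : 2 + 1 = 2 + 1) 1 (freeOperad.bin k θ) (freeOperad.un k ω) :=
  (congrArg (((treeOperad k W).proj _).app 2) (treePreHom_treeOp k W _)).trans
    (freeOperad.comp_bin_un_right k ω θ).symm

theorem freePreHom_succ (ω : W.un) (θ : W.bin) :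
    (freePreHom k W).app 2 (freeOperad.bin k (W := preGens W) (PreGen.succ ω θ)) =
      (freeOperad k W).comp (rfl : 2 + 1 = 2 + 1) 0 (freeOperad.bin k θ) (freeOperad.un k ω) :=
  (congrArg (((treeOperad k W).proj _).app 2) (treePreHom_treeOp k W _)).trans
    (freeOperad.comp_bin_un_left k ω θ).symm

/-- The relators `ker Φ ∩ F(V)(3)`. -/
noncomputable def preRel : Submodule k ((freeOperad k (preGens W)).obj 3) :=
  (preHom k W S).ker.carrier 3

/-- The pre-induced (binary quadratic) operad `F(V) / (ker Φ ∩ F(V)(3))` of `P(W, S)`. -/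
noncomputable def preInducedOperad : Operad.{w, max u v w} k :=
  presentedOperad k (preGens W)
    (Operad.AtArity (freeOperad k (preGens W)) 3 (preRel k W S))

end

/-! ### The operad of commutative algebras with commuting derivations -/

/-- Unary generators `∂_ω`, `ω ∈ Ω`, and one binary generator `μ` with `μ ^ (12) = μ`. -/
def diffGens (Ω : Type u) : UBGens.{u, 0} where
  un := Ω
  bin := Unit
  op := id
  op_op _ := rfl

namespace diffGens

variable (k : Type w) [CommRing k] {Ω : Type u}

/-- `∂_ω` as an element of the free operad. -/
noncomputable def der (ω : Ω) : (freeOperad k (diffGens Ω)).obj 1 :=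
  freeOperad.un k (W := diffGens Ω) ω

/-- `μ` as an element of the free operad. -/
noncomputable def mu (Ω : Type u) : (freeOperad k (diffGens Ω)).obj 2 :=
  freeOperad.bin k (W := diffGens Ω) ()

end diffGens

open diffGens in
/-- The relators of commutative associative algebras with pairwise commuting derivations. -/
inductive DiffRel (k : Type w) [CommRing k] (Ω : Type u) :
    ∀ n, (freeOperad k (diffGens Ω)).obj n → Prop
  /-- `μ(μ ⊗ id) - μ(id ⊗ μ)` -/
  | assoc : DiffRel k Ω 3
      ((freeOperad k (diffGens Ω)).comp (rfl : 2 + 2 = 3 + 1) 0 (mu k Ω) (mu k Ω) -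
        (freeOperad k (diffGens Ω)).comp (rfl : 2 + 2 = 3 + 1) 1 (mu k Ω) (mu k Ω))
  /-- `μ - μ ^ (12)` -/
  | comm : DiffRel k Ω 2 (mu k Ω - (freeOperad k (diffGens Ω)).act (swap 0 1) (mu k Ω))
  /-- `∂_ω μ - μ(id ⊗ ∂_ω) - μ(∂_ω ⊗ id)` -/
  | leibniz (ω : Ω) : DiffRel k Ω 2
      ((freeOperad k (diffGens Ω)).comp (rfl : 1 + 2 = 2 + 1) 0 (der k ω) (mu k Ω) -
        (freeOperad k (diffGens Ω)).comp (rfl : 2 + 1 = 2 + 1) 1 (mu k Ω) (der k ω) -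
        (freeOperad k (diffGens Ω)).comp (rfl : 2 + 1 = 2 + 1) 0 (mu k Ω) (der k ω))
  /-- `∂_α ∂_β - ∂_β ∂_α` -/
  | commute (α β : Ω) : DiffRel k Ω 1
      ((freeOperad k (diffGens Ω)).comp (rfl : 1 + 1 = 1 + 1) 0 (der k α) (der k β) -
        (freeOperad k (diffGens Ω)).comp (rfl : 1 + 1 = 1 + 1) 0 (der k β) (der k α))

/-- The operad of commutative algebras with pairwise commuting derivations indexed by `Ω`. -/
noncomputable def diffOperad (k : Type w) [CommRing k] (Ω : Type u) : Operad.{w, max u w} k :=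
  presentedOperad k (diffGens Ω) (DiffRel k Ω)

/-- `∂_ω` in the operad of multi-differential commutative algebras. -/
noncomputable def diffOperad.der (k : Type w) [CommRing k] {Ω : Type u} (ω : Ω) :
    (diffOperad k Ω).obj 1 :=
  (presentedOperad.proj k (diffGens Ω) (DiffRel k Ω)).app 1 (diffGens.der k ω)

/-- `μ` in the operad of multi-differential commutative algebras. -/
noncomputable def diffOperad.mu (k : Type w) [CommRing k] (Ω : Type u) :
    (diffOperad k Ω).obj 2 :=
  (presentedOperad.proj k (diffGens Ω) (DiffRel k Ω)).app 2 (diffGens.mu k Ω)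

/-! ### The operad of multi-Novikov algebras -/

/-- The products `▷_ω` and their opposites `▷'_ω`. -/
inductive NovGen (Ω : Type u) : Type u
  | tri : Ω → NovGen Ω
  | tri' : Ω → NovGen Ω

/-- The binary generators `▷_ω`, `▷'_ω` with `▷_ω ^ (12) = ▷'_ω`. -/
def novGens (Ω : Type u) : UBGens.{0, u} where
  un := Empty
  bin := NovGen Ω
  op
    | NovGen.tri ω => NovGen.tri' ω
    | NovGen.tri' ω => NovGen.tri ω
  op_op := by rintro (ω | ω) <;> rfl

namespace novGens

variable (k : Type w) [CommRing k] {Ω : Type u}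

/-- `▷_ω` as an element of the free operad `F(V)`. -/
noncomputable def tri (ω : Ω) : (freeOperad k (novGens Ω)).obj 2 :=
  freeOperad.bin k (W := novGens Ω) (NovGen.tri ω)

/-- `▷'_ω` as an element of the free operad `F(V)`. -/
noncomputable def tri' (ω : Ω) : (freeOperad k (novGens Ω)).obj 2 :=
  freeOperad.bin k (W := novGens Ω) (NovGen.tri' ω)

end novGens

open novGens in
/-- The three families of multi-Novikov relators. -/
inductive NovRelator (k : Type w) [CommRing k] (Ω : Type u) : (freeOperad k (novGens Ω)).obj 3 → Prop
  /-- `(x ▷_α y) ▷_β z - x ▷_α (y ▷_β z) - (y ▷_α x) ▷_β z + y ▷_α (x ▷_β z)` -/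
  | left (α β : Ω) : NovRelator k Ω
      ((freeOperad k (novGens Ω)).circI (tri k β) (tri k α) -
        (freeOperad k (novGens Ω)).circII (tri' k α) (tri k β) -
        (freeOperad k (novGens Ω)).circI (tri k β) (tri' k α) +
        (freeOperad k (novGens Ω)).circIII (tri' k α) (tri' k β))
  /-- `(x ▷_α y) ▷_β z - x ▷_α (y ▷_β z) - (x ▷_β y) ▷_α z + x ▷_β (y ▷_α z)` -/
  | exchange (α β : Ω) : NovRelator k Ω
      ((freeOperad k (novGens Ω)).circI (tri k β) (tri k α) -
        (freeOperad k (novGens Ω)).circII (tri' k α) (tri k β) -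
        (freeOperad k (novGens Ω)).circI (tri k α) (tri k β) +
        (freeOperad k (novGens Ω)).circII (tri' k β) (tri k α))
  /-- `(x ▷_α y) ▷_β z - (x ▷_β z) ▷_α y` -/
  | right (α β : Ω) : NovRelator k Ω
      ((freeOperad k (novGens Ω)).circI (tri k β) (tri k α) -
        (freeOperad k (novGens Ω)).circIII (tri k α) (tri' k β))

/-- The `k S₃`-module generated by the multi-Novikov relators. -/
noncomputable def novRel (k : Type w) [CommRing k] (Ω : Type u) :
    Submodule k ((freeOperad k (novGens Ω)).obj 3) :=
  (freeOperad k (novGens Ω)).symSpan {r | NovRelator k Ω r}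

/-- The operad of multi-Novikov algebras. -/
noncomputable def novOperad (k : Type w) [CommRing k] (Ω : Type u) : Operad.{w, max u w} k :=
  presentedOperad k (novGens Ω) (Operad.AtArity (freeOperad k (novGens Ω)) 3 (novRel k Ω))

/-- `▷_ω` in the operad of multi-Novikov algebras. -/
noncomputable def novOperad.tri (k : Type w) [CommRing k] {Ω : Type u} (ω : Ω) :
    (novOperad k Ω).obj 2 :=
  (presentedOperad.proj k (novGens Ω) _).app 2 (novGens.tri k ω)

/-- `▷'_ω` in the operad of multi-Novikov algebras. -/
noncomputable def novOperad.tri' (k : Type w) [CommRing k] {Ω : Type u} (ω : Ω) :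
    (novOperad k Ω).obj 2 :=
  (presentedOperad.proj k (novGens Ω) _).app 2 (novGens.tri' k ω)

/-- The pre-induced operad of the operad of commutative algebras with commuting derivations. -/
noncomputable def preDiffOperad (k : Type w) [CommRing k] (Ω : Type u) : Operad.{w, max u w} k :=
  preInducedOperad k (diffGens Ω) (DiffRel k Ω)

/-- `≺_{ω,μ}` in the pre-induced operad. -/
noncomputable def preDiffOperad.prec (k : Type w) [CommRing k] {Ω : Type u} (ω : Ω) :
    (preDiffOperad k Ω).obj 2 :=
  (presentedOperad.proj k (preGens (diffGens Ω)) _).app 2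
    (freeOperad.bin k (W := preGens (diffGens Ω)) (PreGen.prec (W := diffGens Ω) ω ()))

/-- `≻_{ω,μ}` in the pre-induced operad. -/
noncomputable def preDiffOperad.succ (k : Type w) [CommRing k] {Ω : Type u} (ω : Ω) :
    (preDiffOperad k Ω).obj 2 :=
  (presentedOperad.proj k (preGens (diffGens Ω)) _).app 2
    (freeOperad.bin k (W := preGens (diffGens Ω)) (PreGen.succ (W := diffGens Ω) ω ()))

/-- The morphism `Φ : F(V) → diffOperad` with `▷_ω ↦ μ(id ⊗ ∂_ω)`, `▷'_ω ↦ μ'(∂_ω ⊗ id)`, where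
`μ' = μ ^ (12)`. -/
def IsNovInduced {k : Type w} [CommRing k] {Ω : Type u}
    (Φ : Operad.Hom (freeOperad k (novGens Ω)) (diffOperad k Ω)) : Prop :=
  ∀ ω : Ω,
    Φ.app 2 (novGens.tri k ω) = (diffOperad k Ω).comp (rfl : 2 + 1 = 2 + 1) 1
      (diffOperad.mu k Ω) (diffOperad.der k ω) ∧
    Φ.app 2 (novGens.tri' k ω) = (diffOperad k Ω).comp (rfl : 2 + 1 = 2 + 1) 0
      ((diffOperad k Ω).act (swap 0 1) (diffOperad.mu k Ω)) (diffOperad.der k ω)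

-- Write `x ▷_α y` as x ∂_α(y). The Leibniz rule gives x ∂_α(y ∂_β z) = x y ∂_α∂_β z + x ∂_α(y)
-- ∂_β(z). Hence the associator (x ▷_α y) ▷_β z - x ▷_α (y ▷_β z) has image -x y ∂_α∂_β z, symmetric
-- in x, y and in α, β, while (x ▷_α y) ▷_β z has image x ∂_α(y) ∂_β(z), symmetric under exchange of
-- (α, y) and (β, z). These symmetries are the three families of relators, so the relators lie in
-- the kernel (`novRel_le_ker_novHom`).
--
-- For the converse no basis of the differential operad is needed, only enough linear functionals on
-- it. Suppose that the i-th input is a simultaneous eigenvector of all ∂_ω with eigenvalues c i ω.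
-- An operation then multiplies the product of the inputs by a scalar, its symbol. Symbols respect
-- the defining relations and descend to the differential operad (`diffSymbols`). With
-- indeterminates X(i, ω) as eigenvalues, (a ▷_α b) ▷_β c has symbol X(b, α) X(c, β), and a ▷_α (b
-- ▷_β c) has symbol X(b, α) X(c, β) + X(c, α) X(c, β).
--
-- From these symbols the operation can be recovered modulo the relators. Send X(b, α) X(c, β) with
-- b ≠ c to the class of (a ▷_α b) ▷_β c, and X(c, α) X(c, β) to minus the class of the associator
-- of a, b, c. That this depends only on the unordered pair of variables, and not on the order of a
-- and b, is again exactly the three families (`classOfSymbol_comm`, `classOfSymbol_self`). The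
-- resulting linear map composed with the symbol is the quotient map, so vanishing of the symbol
-- forces membership in the relators (`ker_symbolMap_le`), and `ker_novHom` follows.
--
-- A morphism is determined on quadratic elements by its values on the generators, so the kernel
-- computation for one morphism serves all of them. The generators ▷_ω, ▷'_ω correspond bijectively
-- to ≺_{ω,μ}, ≻_{ω,μ}; under the induced isomorphism of free operads the two spaces of relators
-- match, which gives the isomorphism of quotients.

universe u' v'

/-! ### Free operads: spanning by trees and functoriality in the generators -/

theorem treeOperad.span_range_treeOp (k : Type w) [CommRing k] (W : UBGens.{u, v}) (n : ℕ) :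
    Submodule.span k (Set.range (treeOp k : TreeMonomial W n → _)) = ⊤ := by
  refine eq_top_iff.2 fun (x : TreeMonomial W n →₀ k) _ => ?_
  have h := Finsupp.mem_span_range_iff_exists_finsupp (R := k)
    (v := fun t : TreeMonomial W n => (Finsupp.single t 1 : TreeMonomial W n →₀ k)) (x := x)
  exact h.2 ⟨x, by simp⟩

/-- The projection from the operad of tree monomials to the free operad. -/
noncomputable def freeOperad.projTree (k : Type w) [CommRing k] (W : UBGens.{u, v}) :
    Operad.Hom (treeOperad k W) (freeOperad k W) :=
  (treeOperad k W).proj ((treeOperad k W).idealSpan (SymRel k W))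

theorem freeOperad.span_range_ofTree (k : Type w) [CommRing k] (W : UBGens.{u, v}) (n : ℕ) :
    Submodule.span k (Set.range (freeOperad.ofTree k : TreeMonomial W n → _)) = ⊤ := by
  let F := (freeOperad.projTree k W).app n
  have hF : LinearMap.range F = ⊤ := LinearMap.range_eq_top.2 (Submodule.mkQ_surjective _)
  have h : Set.range (freeOperad.ofTree k : TreeMonomial W n → _) =
      F '' Set.range (treeOp k) := by
    rw [← Set.range_comp]
    rfl
  rw [h, Submodule.span_image, treeOperad.span_range_treeOp, Submodule.map_top]
  exact hF

/-- Reduces every linear identity on the free operad to tree monomials, although these are not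
independent there because of θ(s, t) = θ'(t, s). -/
theorem freeOperad.linearMap_ext {k : Type w} [CommRing k] {W : UBGens.{u, v}} {n : ℕ}
    {M : Type w'} [AddCommGroup M] [Module k M] {f g : (freeOperad k W).obj n →ₗ[k] M}
    (h : ∀ t, f (freeOperad.ofTree k t) = g (freeOperad.ofTree k t)) : f = g :=
  LinearMap.ext_on_range (freeOperad.span_range_ofTree k W n) h

/-- A map of generators compatible with the involutions. -/
structure UBGens.Map (W : UBGens.{u, v}) (W' : UBGens.{u', v'}) where
  un : W.un → W'.un
  bin : W.bin → W'.bin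
  map_op : ∀ θ, bin (W.op θ) = W'.op (bin θ)

section Relabel

variable {W : UBGens.{u, v}} {W' : UBGens.{u', v'}}

/-- Relabelling of the vertices of a tree. -/
def UBTree.relabel (f : W.Map W') {X : Type} : UBTree W X → UBTree W' X
  | leaf x => leaf x
  | un ω t => un (f.un ω) (relabel f t)
  | bin θ s t => bin (f.bin θ) (relabel f s) (relabel f t)

theorem UBTree.leaves_relabel (f : W.Map W') {X : Type} (t : UBTree W X) :
    (t.relabel f).leaves = t.leaves := by
  induction t with
  | leaf x => rfl
  | un ω t ih => exact ih
  | bin θ s t ihs iht => simp only [relabel, leaves, ihs, iht]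

theorem UBTree.relabel_bind (f : W.Map W') {X Y : Type} (t : UBTree W X)
    (g : X → UBTree W Y) : (t.bind g).relabel f = (t.relabel f).bind fun x => (g x).relabel f := by
  induction t with
  | leaf x => rfl
  | un ω t ih => simp only [relabel, bind, ih]
  | bin θ s t ihs iht => simp only [relabel, bind, ihs, iht]

theorem UBTree.relabel_relabel (f : W.Map W') (g : W'.Map W) (hun : ∀ ω, g.un (f.un ω) = ω)
    (hbin : ∀ θ, g.bin (f.bin θ) = θ) {X : Type} (t : UBTree W X) :
    (t.relabel f).relabel g = t := by
  induction t with
  | leaf x => rfl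
  | un ω t ih => simp only [relabel, ih, hun]
  | bin θ s t ihs iht => simp only [relabel, ihs, iht, hbin]

namespace TreeMonomial

/-- Relabelling of the vertices of a tree monomial. -/
def relabel (f : W.Map W') {n : ℕ} (t : TreeMonomial W n) : TreeMonomial W' n :=
  ⟨t.1.relabel f, by rw [UBTree.leaves_relabel, t.2]⟩

theorem relabel_perm (f : W.Map W') {n : ℕ} (σ : Perm (Fin n)) (t : TreeMonomial W n) :
    (perm σ t).relabel f = perm σ (t.relabel f) :=
  Subtype.ext (UBTree.relabel_bind f t.1 _)

theorem relabel_graft (f : W.Map W') {m n l : ℕ} (h : m + n = l + 1) (i : Fin m)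
    (s : TreeMonomial W m) (t : TreeMonomial W n) :
    (graft h i s t).relabel f = graft h i (s.relabel f) (t.relabel f) := by
  refine Subtype.ext ((UBTree.relabel_bind f s.1 _).trans ?_)
  simp only [graft, relabel]
  congr 1
  funext x
  by_cases hx : x = i
  · subst hx
    rw [graftFun_self, graftFun_self]
    exact UBTree.relabel_bind f t.1 _
  · rw [graftFun_ne _ _ _ _ hx, graftFun_ne _ _ _ _ hx]
    rfl

end TreeMonomial

/-- The morphism of tree operads induced by a map of generators. -/
noncomputable def treeMapHom (k : Type w) [CommRing k] (f : W.Map W') :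
    Operad.Hom (treeOperad k W) (treeOperad k W') where
  app n := Finsupp.lmapDomain k k (TreeMonomial.relabel f)
  map_act {n} σ := by
    intro (μ : TreeMonomial W n →₀ k)
    change Finsupp.mapDomain _ (Finsupp.mapDomain _ μ) =
      Finsupp.mapDomain _ (Finsupp.mapDomain _ μ)
    rw [← Finsupp.mapDomain_comp, ← Finsupp.mapDomain_comp]
    congr 1
    funext t
    exact TreeMonomial.relabel_perm f σ t
  map_one := Finsupp.mapDomain_single
  map_comp {m n l} h i := by
    intro (μ : TreeMonomial W m →₀ k) (ν : TreeMonomial W n →₀ k)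
    change Finsupp.lmapDomain k k (TreeMonomial.relabel f) (treeComp k W h i μ ν) =
      treeComp k W' h i (Finsupp.lmapDomain k k (TreeMonomial.relabel f) μ)
        (Finsupp.lmapDomain k k (TreeMonomial.relabel f) ν)
    induction μ using Finsupp.induction_linear with
    | zero => simp only [map_zero, LinearMap.zero_apply]
    | add f g hf hg => simp only [map_add, LinearMap.add_apply, hf, hg]
    | single t c =>
      induction ν using Finsupp.induction_linear with
      | zero => simp only [map_zero]
      | add f g hf hg => simp only [map_add, hf, hg]
      | single t' c' =>
        simp only [treeComp_single, Finsupp.lmapDomain_apply, Finsupp.mapDomain_single,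
          TreeMonomial.relabel_graft]

theorem treeMapHom_treeOp (k : Type w) [CommRing k] (f : W.Map W') {n : ℕ}
    (t : TreeMonomial W n) : (treeMapHom k f).app n (treeOp k t) = treeOp k (t.relabel f) :=
  Finsupp.mapDomain_single

/-- The morphism of free operads induced by a map of generators. -/
noncomputable def freeMapHom (k : Type w) [CommRing k] (f : W.Map W') :
    Operad.Hom (freeOperad k W) (freeOperad k W') :=
  ((treeMapHom k f).trans
    ((treeOperad k W').proj ((treeOperad k W').idealSpan (SymRel k W')))).lift _ (by
      refine Operad.idealSpan_le _ _ _ ?_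
      rintro n _ ⟨θ⟩
      refine (map_sub (((treeMapHom k f).trans _).app 2) _ _).trans (sub_eq_zero.2 ?_)
      rw [Operad.Hom.map_act]
      have key : ∀ θ, ((treeMapHom k f).trans ((treeOperad k W').proj
          ((treeOperad k W').idealSpan (SymRel k W')))).app 2
          (treeOp k (TreeMonomial.binTree θ)) = freeOperad.bin k (f.bin θ) := fun θ =>
        congrArg (((treeOperad k W').proj _).app 2) (treeMapHom_treeOp k f _)
      refine (congrArg ((freeOperad k W').act (swap 0 1)) (key θ)).trans ?_
      -- Compatibility of the map with the involutions turns the symmetry relation of θ into that of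
      -- its image.
      rw [freeOperad.act_bin, ← f.map_op]
      exact (key _).symm)

theorem freeMapHom_ofTree (k : Type w) [CommRing k] (f : W.Map W') {n : ℕ}
    (t : TreeMonomial W n) :
    (freeMapHom k f).app n (freeOperad.ofTree k t) = freeOperad.ofTree k (t.relabel f) :=
  congrArg (((treeOperad k W').proj _).app n) (treeMapHom_treeOp k f t)

theorem freeMapHom_freeMapHom (k : Type w) [CommRing k] (f : W.Map W') (g : W'.Map W)
    (hun : ∀ ω, g.un (f.un ω) = ω) (hbin : ∀ θ, g.bin (f.bin θ) = θ) {n : ℕ}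
    (x : (freeOperad k W).obj n) : (freeMapHom k g).app n ((freeMapHom k f).app n x) = x := by
  suffices ((freeMapHom k g).app n).comp ((freeMapHom k f).app n) = LinearMap.id from
    LinearMap.congr_fun this x
  refine freeOperad.linearMap_ext fun t => ?_
  rw [LinearMap.comp_apply, freeMapHom_ofTree, freeMapHom_ofTree]
  exact congrArg (freeOperad.ofTree k) (Subtype.ext (UBTree.relabel_relabel f g hun hbin t.1))

end Relabel

theorem freePreHom_ofTree (k : Type w) [CommRing k] (W : UBGens.{u, v}) {n : ℕ}
    (t : TreeMonomial (preGens W) n) :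
    (freePreHom k W).app n (freeOperad.ofTree k t) = freeOperad.ofTree k t.pre :=
  congrArg (((treeOperad k W).proj _).app n) (treePreHom_treeOp k W t)

/-! ### The generators of multi-Novikov algebras as pre-induced generators -/

namespace novGens

variable {Ω : Type u}

/-- `▷_ω ↦ ≺_{ω,μ}`, `▷'_ω ↦ ≻_{ω,μ}`. -/
def toPre (Ω : Type u) : (novGens Ω).Map (preGens (diffGens Ω)) where
  un := Empty.elim
  bin
    | NovGen.tri ω => PreGen.prec (W := diffGens Ω) ω ()
    | NovGen.tri' ω => PreGen.succ (W := diffGens Ω) ω ()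
  map_op := by rintro (ω | ω) <;> rfl

/-- `≺_{ω,μ} ↦ ▷_ω`, `≻_{ω,μ} ↦ ▷'_ω`. -/
def ofPre (Ω : Type u) : (preGens (diffGens Ω)).Map (novGens Ω) where
  un := Empty.elim
  bin
    | PreGen.prec ω _ => NovGen.tri ω
    | PreGen.succ ω _ => NovGen.tri' ω
  map_op := by rintro (⟨ω, θ⟩ | ⟨ω, θ⟩) <;> rfl

theorem ofPre_toPre (k : Type w) [CommRing k] {n : ℕ} (x : (freeOperad k (novGens Ω)).obj n) :
    (freeMapHom k (ofPre Ω)).app n ((freeMapHom k (toPre Ω)).app n x) = x :=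
  freeMapHom_freeMapHom k _ _ (fun ω => Empty.elim ω) (by rintro (ω | ω) <;> rfl) x

theorem toPre_ofPre (k : Type w) [CommRing k] {n : ℕ}
    (x : (freeOperad k (preGens (diffGens Ω))).obj n) :
    (freeMapHom k (toPre Ω)).app n ((freeMapHom k (ofPre Ω)).app n x) = x :=
  freeMapHom_freeMapHom k _ _ (fun ω => Empty.elim ω)
    (by rintro (⟨ω, ⟨⟩⟩ | ⟨ω, ⟨⟩⟩) <;> rfl) x

end novGens

/-- The class in the operad of multi-differential algebras of a tree monomial. -/
noncomputable def diffOperad.ofTree (k : Type w) [CommRing k] {Ω : Type u} {n : ℕ}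
    (t : TreeMonomial (diffGens Ω) n) : (diffOperad k Ω).obj n :=
  (presentedOperad.proj k (diffGens Ω) (DiffRel k Ω)).app n (freeOperad.ofTree k t)

/-- The morphism `▷_ω ↦ μ(id ⊗ ∂_ω)`, `▷'_ω ↦ μ(∂_ω ⊗ id)`. -/
noncomputable def novHom (k : Type w) [CommRing k] (Ω : Type u) :
    Operad.Hom (freeOperad k (novGens Ω)) (diffOperad k Ω) :=
  (freeMapHom k (novGens.toPre Ω)).trans (preHom k (diffGens Ω) (DiffRel k Ω))

theorem novHom_ofTree (k : Type w) [CommRing k] {Ω : Type u} {n : ℕ}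
    (t : TreeMonomial (novGens Ω) n) :
    (novHom k Ω).app n (freeOperad.ofTree k t) =
      diffOperad.ofTree k (t.relabel (novGens.toPre Ω)).pre := by
  refine (congrArg ((preHom k (diffGens Ω) (DiffRel k Ω)).app n)
    (freeMapHom_ofTree k (novGens.toPre Ω) t)).trans ?_
  exact congrArg ((presentedOperad.proj k (diffGens Ω) (DiffRel k Ω)).app n)
    (freePreHom_ofTree k _ _)

/-! ### The defining relations as identities in the differential operad -/

namespace diffOperad

variable (k : Type w) [CommRing k] {Ω : Type u}

theorem act_ofTree {n : ℕ} (σ : Perm (Fin n)) (t : TreeMonomial (diffGens Ω) n) :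
    (diffOperad k Ω).act σ (ofTree k t) = ofTree k (t.perm σ) :=
  congrArg (Submodule.mkQ _) (freeOperad.act_ofTree k σ t)

theorem comp_ofTree {m n l : ℕ} (h : m + n = l + 1) (i : Fin m) (s : TreeMonomial (diffGens Ω) m)
    (t : TreeMonomial (diffGens Ω) n) :
    (diffOperad k Ω).comp h i (ofTree k s) (ofTree k t) =
      ofTree k (TreeMonomial.graft h i s t) :=
  congrArg (Submodule.mkQ _) (freeOperad.comp_ofTree k h i s t)

theorem mu_eq_ofTree : mu k Ω = ofTree k (TreeMonomial.binTree (W := diffGens Ω) ()) := rfl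

theorem der_eq_ofTree (ω : Ω) :
    der k ω = ofTree k (TreeMonomial.unTree (W := diffGens Ω) ω) := rfl

theorem eq_zero_of_rel {n : ℕ} {r : (freeOperad k (diffGens Ω)).obj n} (h : DiffRel k Ω n r) :
    (presentedOperad.proj k (diffGens Ω) (DiffRel k Ω)).app n r = 0 :=
  (Submodule.Quotient.mk_eq_zero _).2
    ((freeOperad k (diffGens Ω)).subset_idealSpan (DiffRel k Ω) n h)

theorem act_swap_mu : (diffOperad k Ω).act (swap 0 1) (mu k Ω) = mu k Ω :=
  (sub_eq_zero.1 ((map_sub _ _ _).symm.trans (eq_zero_of_rel k (DiffRel.comm (Ω := Ω))))).symm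

theorem comp_mu_mu : (diffOperad k Ω).comp (rfl : 2 + 2 = 3 + 1) 0 (mu k Ω) (mu k Ω) =
    (diffOperad k Ω).comp (rfl : 2 + 2 = 3 + 1) 1 (mu k Ω) (mu k Ω) :=
  sub_eq_zero.1 ((map_sub _ _ _).symm.trans (eq_zero_of_rel k (DiffRel.assoc (Ω := Ω))))

theorem comp_der_der (α β : Ω) :
    (diffOperad k Ω).comp (rfl : 1 + 1 = 1 + 1) 0 (der k α) (der k β) =
      (diffOperad k Ω).comp (rfl : 1 + 1 = 1 + 1) 0 (der k β) (der k α) :=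
  sub_eq_zero.1 ((map_sub _ _ _).symm.trans (eq_zero_of_rel k (DiffRel.commute α β)))

theorem comp_der_mu (ω : Ω) :
    (diffOperad k Ω).comp (rfl : 1 + 2 = 2 + 1) 0 (der k ω) (mu k Ω) =
      (diffOperad k Ω).comp (rfl : 2 + 1 = 2 + 1) 1 (mu k Ω) (der k ω) +
        (diffOperad k Ω).comp (rfl : 2 + 1 = 2 + 1) 0 (mu k Ω) (der k ω) := by
  have h := eq_zero_of_rel k (DiffRel.leibniz (k := k) ω)
  rw [map_sub, map_sub, sub_sub] at h
  exact sub_eq_zero.1 h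

end diffOperad

/-- The condition involves μ' = μ^(12) whereas ≻_{ω,μ} goes to μ(∂_ω ⊗ id); commutativity of μ
reconciles the two. -/
theorem isNovInduced_novHom (k : Type w) [CommRing k] (Ω : Type u) :
    IsNovInduced (novHom k Ω) := by
  intro ω
  rw [diffOperad.act_swap_mu, diffOperad.mu_eq_ofTree, diffOperad.der_eq_ofTree,
    diffOperad.comp_ofTree, diffOperad.comp_ofTree]
  exact ⟨novHom_ofTree k _, novHom_ofTree k _⟩

/-! ### Symbols of differential operations -/

namespace Operad

/-- The weights of the inputs of `μ` in `μ ∘ᵢ ν` when the inputs of `μ ∘ᵢ ν` have weights `c`. -/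
def graftWeight {Ω : Type u} {R : Type v} [CommRing R] {m n l : ℕ} (h : m + n = l + 1) (i : Fin m)
    (c : Fin l → Ω → R) (x : Fin m) (ω : Ω) : R :=
  if hx : x = i then ∑ b, c (inner h i b) ω else c (outer h i x hx) ω

/-- Linear functionals on an operad, depending on a weight `c i ω` for each input `i` and each
`ω ∈ Ω`, that are compatible with the operad structure in the way the symbols of differential
operations are. -/
structure Symbols {k : Type w} [CommRing k] (P : Operad.{w, w'} k) (Ω : Type u) (R : Type v)
    [CommRing R] [Algebra k R] where
  app : ∀ n, (Fin n → Ω → R) → P.obj n →ₗ[k] R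
  app_act : ∀ {n : ℕ} (c : Fin n → Ω → R) (σ : Perm (Fin n)) (μ : P.obj n),
    app n c (P.act σ μ) = app n (fun x => c (σ⁻¹ x)) μ
  app_comp : ∀ {m n l : ℕ} (h : m + n = l + 1) (i : Fin m) (c : Fin l → Ω → R) (μ : P.obj m)
    (ν : P.obj n), app l c (P.comp h i μ ν) =
      app m (graftWeight h i c) μ * app n (fun b => c (inner h i b)) ν

namespace Symbols

variable {k : Type w} [CommRing k] {P : Operad.{w, w'} k} {Ω : Type u} {R : Type v}
  [CommRing R] [Algebra k R]

/-- The operations whose symbols all vanish. -/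
def ker (S : P.Symbols Ω R) : P.Ideal where
  -- All weights are imposed at once, since the symbol of a composite evaluates its factors at
  -- weights other than its own.
  carrier n := ⨅ c, LinearMap.ker (S.app n c)
  act_mem σ μ hμ := by
    simp only [Submodule.mem_iInf, LinearMap.mem_ker] at hμ ⊢
    intro c
    rw [S.app_act, hμ]
  comp_mem_left h i μ ν hμ := by
    simp only [Submodule.mem_iInf, LinearMap.mem_ker] at hμ ⊢
    intro c
    rw [S.app_comp, hμ, zero_mul]
  comp_mem_right h i μ ν hν := by
    simp only [Submodule.mem_iInf, LinearMap.mem_ker] at hν ⊢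
    intro c
    rw [S.app_comp, hν, mul_zero]

theorem mem_ker (S : P.Symbols Ω R) {n : ℕ} {μ : P.obj n} :
    μ ∈ S.ker.carrier n ↔ ∀ c, S.app n c μ = 0 := by
  simp only [ker, Submodule.mem_iInf, LinearMap.mem_ker]

/-- The symbols on the quotient by an ideal generated by operations with vanishing symbols. -/
def lift (S : P.Symbols Ω R) (r : ∀ n, Set (P.obj n))
    (hr : ∀ n, ∀ x ∈ r n, ∀ c, S.app n c x = 0) : (P.quotient (P.idealSpan r)).Symbols Ω R where
  app n c := ((P.idealSpan r).carrier n).liftQ (S.app n c) fun _ hx =>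
    S.mem_ker.1 (P.idealSpan_le r S.ker (fun n x hx => S.mem_ker.2 (hr n x hx)) n hx) c
  app_act := by
    rintro n c σ ⟨μ⟩
    exact S.app_act c σ μ
  app_comp := by
    rintro m n l h i c ⟨μ⟩ ⟨ν⟩
    exact S.app_comp h i c μ ν

end Symbols

end Operad

namespace UBTree

variable {Ω : Type u} {R : Type v} [CommRing R] {X Y : Type}

/-- The sum of the weights of the leaves. -/
def weight (c : X → Ω → R) : UBTree (diffGens Ω) X → Ω → R
  | leaf x, ω => c x ω
  | un _ t, ω => weight c t ω
  | bin _ s t, ω => weight c s ω + weight c t ω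

/-- The eigenvalue of the operation on the product of eigenvectors `x` of the derivations `∂_ω` with
eigenvalues `c x ω`. -/
def symbol (c : X → Ω → R) : UBTree (diffGens Ω) X → R
  | leaf _ => 1
  | un ω t => weight c t ω * symbol c t
  | bin _ s t => symbol c s * symbol c t

/-- A derivation does not change the weight and a product adds weights. Hence a tree monomial,
having each label once, has the total weight of its inputs. -/
theorem weight_eq_sum (c : X → Ω → R) (t : UBTree (diffGens Ω) X) (ω : Ω) :
    weight c t ω = (t.leaves.map fun x => c x ω).sum := by
  induction t with
  | leaf x => simp [weight, leaves]
  | un α t ih => exact ih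
  | bin θ s t ihs iht => simp [weight, leaves, ihs, iht]

theorem weight_bind (c : Y → Ω → R) (t : UBTree (diffGens Ω) X)
    (f : X → UBTree (diffGens Ω) Y) (ω : Ω) :
    weight c (t.bind f) ω = weight (fun x => weight c (f x)) t ω := by
  induction t with
  | leaf x => rfl
  | un α t ih => exact ih
  | bin θ s t ihs iht => simp only [weight, bind, ihs, iht]

/-- Each substituted tree contributes a scalar, and its output is an eigenvector whose weight is
that of the substituted tree. The outer tree therefore sees these new weights, and the scalars
multiply. -/
theorem symbol_bind (c : Y → Ω → R) (t : UBTree (diffGens Ω) X)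
    (f : X → UBTree (diffGens Ω) Y) :
    symbol c (t.bind f) =
      symbol (fun x => weight c (f x)) t * (t.leaves.map fun x => symbol c (f x)).prod := by
  induction t with
  | leaf x => simp [symbol, bind, leaves]
  | un α t ih =>
    simp only [symbol, bind, leaves, ih, mul_assoc]
    exact congrArg (· * _) (weight_bind c t f α)
  | bin θ s t ihs iht =>
    simp only [symbol, bind, leaves, ihs, iht, Multiset.map_add, Multiset.prod_add]
    ring

theorem symbol_map (c : Y → Ω → R) (t : UBTree (diffGens Ω) X) (f : X → Y) :
    symbol c (t.map f) = symbol (fun x => c (f x)) t := by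
  rw [map, symbol_bind]
  simp [symbol]
  rfl

end UBTree

namespace TreeMonomial

variable {Ω : Type u} {R : Type v} [CommRing R]

theorem symbol_graft {m n l : ℕ} (h : m + n = l + 1) (i : Fin m) (c : Fin l → Ω → R)
    (s : TreeMonomial (diffGens Ω) m) (t : TreeMonomial (diffGens Ω) n) :
    (graft h i s t).1.symbol c =
      s.1.symbol (Operad.graftWeight h i c) * t.1.symbol (fun b => c (Operad.inner h i b)) := by
  have hw : (fun x => UBTree.weight c (graftFun h i t.1 x)) = Operad.graftWeight h i c := by
    funext x ω
    by_cases hx : x = i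
    · subst hx
      rw [graftFun_self, UBTree.weight_eq_sum, UBTree.leaves_map, t.2, Multiset.map_map]
      simp [Operad.graftWeight, Finset.sum]
    · rw [graftFun_ne _ _ _ _ hx]
      simp [Operad.graftWeight, hx, UBTree.weight]
  rw [graft, UBTree.symbol_bind, hw, s.2]
  congr 1
  -- Inputs other than `i` are only renumbered, so they contribute the factor 1.
  refine (Fintype.prod_eq_single i fun x hx => ?_).trans ?_
  · rw [graftFun_ne _ _ _ _ hx]
    rfl
  · rw [graftFun_self, UBTree.symbol_map]

end TreeMonomial

namespace diffGens

variable (k : Type w) [CommRing k] {Ω : Type u}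

theorem mu_eq_ofTree :
    mu k Ω = freeOperad.ofTree k (TreeMonomial.binTree (W := diffGens Ω) ()) := rfl

theorem der_eq_ofTree (ω : Ω) :
    der k ω = freeOperad.ofTree k (TreeMonomial.unTree (W := diffGens Ω) ω) := rfl

end diffGens

section

variable (k : Type w) [CommRing k] (Ω : Type u) (R : Type v) [CommRing R] [Algebra k R]

/-- The symbols of tree monomials, extended linearly. -/
noncomputable def treeSymbols : (treeOperad k (diffGens Ω)).Symbols Ω R where
  app n c := Finsupp.linearCombination k fun t : TreeMonomial (diffGens Ω) n => t.1.symbol c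
  app_act {n} c σ := by
    intro (μ : TreeMonomial (diffGens Ω) n →₀ k)
    refine (Finsupp.linearCombination_mapDomain k (TreeMonomial.perm σ) μ).trans ?_
    congr 2
    funext t
    exact UBTree.symbol_map c t.1 _
  app_comp {m n l} h i c := by
    intro (μ : TreeMonomial (diffGens Ω) m →₀ k) (ν : TreeMonomial (diffGens Ω) n →₀ k)
    change Finsupp.linearCombination k _ (treeComp k (diffGens Ω) h i μ ν) =
      Finsupp.linearCombination k _ μ * Finsupp.linearCombination k _ ν
    induction μ using Finsupp.induction_linear with
    | zero => simp only [map_zero, LinearMap.zero_apply, zero_mul]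
    | add f g hf hg => simp only [map_add, LinearMap.add_apply, hf, hg, add_mul]
    | single t a =>
      induction ν using Finsupp.induction_linear with
      | zero => simp only [map_zero, mul_zero]
      | add f g hf hg => simp only [map_add, hf, hg, mul_add]
      | single t' a' =>
        simp only [treeComp_single, Finsupp.linearCombination_single, TreeMonomial.symbol_graft,
          smul_mul_smul_comm]

theorem treeSymbols_treeOp {n : ℕ} (c : Fin n → Ω → R) (t : TreeMonomial (diffGens Ω) n) :
    (treeSymbols k Ω R).app n c (treeOp k t) = t.1.symbol c :=
  (Finsupp.linearCombination_single k _ _).trans (one_smul _ _)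

/-- The symbols on the free operad. -/
noncomputable def freeSymbols : (freeOperad k (diffGens Ω)).Symbols Ω R :=
  (treeSymbols k Ω R).lift (SymRel k (diffGens Ω)) (by
    rintro n _ ⟨θ⟩ c
    rw [map_sub, act_treeOp, treeSymbols_treeOp, treeSymbols_treeOp, sub_eq_zero]
    rfl)

theorem freeSymbols_ofTree {n : ℕ} (c : Fin n → Ω → R) (t : TreeMonomial (diffGens Ω) n) :
    (freeSymbols k Ω R).app n c (freeOperad.ofTree k t) = t.1.symbol c :=
  treeSymbols_treeOp k Ω R c t

/-- The symbols of multi-differential operations. -/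
noncomputable def diffSymbols : (diffOperad k Ω).Symbols Ω R :=
  (freeSymbols k Ω R).lift (DiffRel k Ω) (by
    rintro n _ hx c
    cases hx with
    | assoc =>
      rw [map_sub, diffGens.mu_eq_ofTree, freeOperad.comp_ofTree, freeOperad.comp_ofTree,
        freeSymbols_ofTree, freeSymbols_ofTree, sub_eq_zero]
      exact mul_assoc 1 1 1
    | comm =>
      rw [map_sub, diffGens.mu_eq_ofTree, freeOperad.act_ofTree,
        freeSymbols_ofTree, freeSymbols_ofTree, sub_eq_zero]
      rfl
    | leibniz ω =>
      rw [map_sub, map_sub, diffGens.mu_eq_ofTree, diffGens.der_eq_ofTree,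
        freeOperad.comp_ofTree, freeOperad.comp_ofTree, freeOperad.comp_ofTree,
        freeSymbols_ofTree, freeSymbols_ofTree, freeSymbols_ofTree]
      -- On eigenvectors the Leibniz rule says that the eigenvalue of a product is the sum of the
      -- eigenvalues.
      change (c 0 ω + c 1 ω) * (1 * 1) - 1 * (c 1 ω * 1) - c 0 ω * 1 * 1 = 0
      ring
    | commute α β =>
      rw [map_sub, diffGens.der_eq_ofTree, diffGens.der_eq_ofTree,
        freeOperad.comp_ofTree, freeOperad.comp_ofTree,
        freeSymbols_ofTree, freeSymbols_ofTree]
      change c 0 α * (c 0 β * 1) - c 0 β * (c 0 α * 1) = 0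
      ring)

theorem diffSymbols_ofTree {n : ℕ} (c : Fin n → Ω → R) (t : TreeMonomial (diffGens Ω) n) :
    (diffSymbols k Ω R).app n c (diffOperad.ofTree k t) = t.1.symbol c :=
  freeSymbols_ofTree k Ω R c t

end

/-! ### Trees with arbitrary leaf labels as operations -/

open scoped Classical in
/-- The action of a self-map of `Fin n` on operations: that of the permutation if the map is
bijective, and zero otherwise. -/
noncomputable def Operad.rename {k : Type w} [CommRing k] (P : Operad.{w, w'} k) {n : ℕ}
    (f : Fin n → Fin n) : P.obj n →ₗ[k] P.obj n :=
  if h : Function.Bijective f then P.act (Equiv.ofBijective f h)⁻¹ else 0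

/-- Bijectivity of `f` does not depend on the operad, so the default value zero occurs on both sides
or on neither. With this convention, identities for the labels 0, 1, 2 carry over to arbitrary
labels without assuming them distinct. -/
theorem Operad.Hom.map_rename {k : Type w} [CommRing k] {P : Operad.{w, w'} k}
    {Q : Operad.{w, w''} k} (F : Operad.Hom P Q) {n : ℕ} (f : Fin n → Fin n) (μ : P.obj n) :
    F.app n (P.rename f μ) = Q.rename f (F.app n μ) := by
  unfold Operad.rename
  split_ifs
  · exact F.map_act _ _
  · simp

namespace freeOperad

variable (k : Type w) [CommRing k] {W : UBGens.{u, v}}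

/-- The class of a tree; it is zero unless every label occurs at exactly one leaf. -/
noncomputable def tree {n : ℕ} (t : UBTree W (Fin n)) : (freeOperad k W).obj n :=
  if h : t.leaves = Finset.univ.val then ofTree k (⟨t, h⟩ : TreeMonomial W n) else 0

theorem tree_eq_ofTree {n : ℕ} {t : UBTree W (Fin n)} (h : t.leaves = Finset.univ.val) :
    tree k t = ofTree k (⟨t, h⟩ : TreeMonomial W n) := dif_pos h

theorem ofTree_eq_tree {n : ℕ} (t : TreeMonomial W n) : ofTree k t = tree k t.1 :=
  (tree_eq_ofTree k t.2).symm

theorem rename_ofTree {n : ℕ} (f : Fin n → Fin n) (t : TreeMonomial W n) :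
    (freeOperad k W).rename f (ofTree k t) = tree k (t.1.map f) := by
  unfold Operad.rename
  split_ifs with hf
  · rw [act_ofTree, ofTree_eq_tree]
    rfl
  · refine Eq.symm (dif_neg ?_)
    rw [UBTree.leaves_map, t.2]
    intro hu
    -- If every label occurred after relabelling, `f` would be surjective and hence bijective on a
    -- finite set.
    refine hf (Finite.surjective_iff_bijective.1 fun y => ?_)
    have hy : y ∈ (Finset.univ : Finset (Fin n)).val := Finset.mem_univ y
    rw [← hu, Multiset.mem_map] at hy
    obtain ⟨x, -, hx⟩ := hy
    exact ⟨x, hx⟩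

theorem tree_swap (θ η : W.bin) (a b c : Fin 3) :
    tree k (.bin θ (.bin η (.leaf a) (.leaf b)) (.leaf c)) =
      tree k (.bin (W.op θ) (.leaf c) (.bin η (.leaf a) (.leaf b))) := by
  -- Grafting `η` at the second input of θ^(12) = θ' gives θ(η(x₁, x₂), x₀) = θ'(x₀, η(x₁, x₂));
  -- then 0, 1, 2 are replaced by `c`, `a`, `b`.
  have h := congrArg (fun x => (freeOperad k W).rename ![c, a, b]
    ((freeOperad k W).comp (rfl : 2 + 2 = 3 + 1) 1 x (bin k η))) (act_bin k θ)
  simp only [bin, act_ofTree, comp_ofTree, rename_ofTree] at h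
  exact h

theorem tree_swap_inner (θ η : W.bin) (a b c : Fin 3) :
    tree k (.bin θ (.bin η (.leaf a) (.leaf b)) (.leaf c)) =
      tree k (.bin θ (.bin (W.op η) (.leaf b) (.leaf a)) (.leaf c)) := by
  have h := congrArg (fun x => (freeOperad k W).rename ![b, a, c]
    ((freeOperad k W).comp (rfl : 2 + 2 = 3 + 1) 0 (bin k θ) x)) (act_bin k η)
  simp only [bin, act_ofTree, comp_ofTree, rename_ofTree] at h
  exact h

end freeOperad

/-! ### Leibniz, associativity and commutativity for ternary differential monomials -/

namespace diffOperad

variable (k : Type w) [CommRing k] {Ω : Type u}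

/-- The class of a tree; it is zero unless every label occurs at exactly one leaf. -/
noncomputable def tree {n : ℕ} (t : UBTree (diffGens Ω) (Fin n)) : (diffOperad k Ω).obj n :=
  (presentedOperad.proj k (diffGens Ω) (DiffRel k Ω)).app n (freeOperad.tree k t)

theorem ofTree_eq_tree {n : ℕ} (t : TreeMonomial (diffGens Ω) n) : ofTree k t = tree k t.1 :=
  congrArg ((presentedOperad.proj k (diffGens Ω) (DiffRel k Ω)).app n)
    (freeOperad.ofTree_eq_tree k t)

theorem rename_ofTree {n : ℕ} (f : Fin n → Fin n) (t : TreeMonomial (diffGens Ω) n) :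
    (diffOperad k Ω).rename f (ofTree k t) = tree k (t.1.map f) :=
  ((presentedOperad.proj k (diffGens Ω) (DiffRel k Ω)).map_rename f _).symm.trans
    (congrArg ((presentedOperad.proj k (diffGens Ω) (DiffRel k Ω)).app n)
      (freeOperad.rename_ofTree k f t))

/-- The tree monomial `μ`. -/
def muTree (Ω : Type u) : TreeMonomial (diffGens Ω) 2 := TreeMonomial.binTree (W := diffGens Ω) ()

/-- The tree monomial `∂_ω`. -/
def derTree (ω : Ω) : TreeMonomial (diffGens Ω) 1 := TreeMonomial.unTree (W := diffGens Ω) ω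

theorem mu_eq_ofTree_muTree : mu k Ω = ofTree k (muTree Ω) := rfl

theorem der_eq_ofTree_derTree (ω : Ω) : der k ω = ofTree k (derTree ω) := rfl

/-- The product of two trees. -/
abbrev tmul {X : Type} (s t : UBTree (diffGens Ω) X) : UBTree (diffGens Ω) X := .bin () s t

/-- The derivative of a tree. -/
abbrev tder {X : Type} (ω : Ω) (t : UBTree (diffGens Ω) X) : UBTree (diffGens Ω) X :=
  .un (W := diffGens Ω) ω t

/-- A leaf. -/
abbrev tvar {X : Type} (x : X) : UBTree (diffGens Ω) X := .leaf x

variable (α β : Ω) (a b c : Fin 3)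

/-- Obtained by composing the relation for ∂_α μ into the second input of μ, inserting ∂_β at the
last input and relabelling. The next five identities arise in the same way from the other defining
relations. -/
theorem tree_leibniz :
    tree k (tmul (tvar a) (tder α (tmul (tvar b) (tder β (tvar c))))) =
      tree k (tmul (tvar a) (tmul (tvar b) (tder α (tder β (tvar c))))) +
        tree k (tmul (tvar a) (tmul (tder α (tvar b)) (tder β (tvar c)))) := by
  have h := congrArg (fun x => (diffOperad k Ω).rename ![a, b, c]
    ((diffOperad k Ω).comp (rfl : 3 + 1 = 3 + 1) 2
      ((diffOperad k Ω).comp (rfl : 2 + 2 = 3 + 1) 1 (mu k Ω) x) (der k β))) (comp_der_mu k α)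
  simp only [mu_eq_ofTree_muTree, der_eq_ofTree_derTree, comp_ofTree, map_add,
    LinearMap.add_apply, rename_ofTree] at h
  exact h

theorem tree_assoc_der_der :
    tree k (tmul (tmul (tvar a) (tvar b)) (tder α (tder β (tvar c)))) =
      tree k (tmul (tvar a) (tmul (tvar b) (tder α (tder β (tvar c))))) := by
  have h := congrArg (fun x => (diffOperad k Ω).rename ![a, b, c]
    ((diffOperad k Ω).comp (rfl : 3 + 1 = 3 + 1) 2 x
      ((diffOperad k Ω).comp (rfl : 1 + 1 = 1 + 1) 0 (der k α) (der k β)))) (comp_mu_mu k (Ω := Ω))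
  simp only [mu_eq_ofTree_muTree, der_eq_ofTree_derTree, comp_ofTree, rename_ofTree] at h
  exact h

theorem tree_assoc :
    tree k (tmul (tmul (tvar a) (tder α (tvar b))) (tder β (tvar c))) =
      tree k (tmul (tvar a) (tmul (tder α (tvar b)) (tder β (tvar c)))) := by
  have h := congrArg (fun x => (diffOperad k Ω).rename ![a, b, c]
    ((diffOperad k Ω).comp (rfl : 3 + 1 = 3 + 1) 2
      ((diffOperad k Ω).comp (rfl : 3 + 1 = 3 + 1) 1 x (der k α)) (der k β))) (comp_mu_mu k (Ω := Ω))
  simp only [mu_eq_ofTree_muTree, der_eq_ofTree_derTree, comp_ofTree, rename_ofTree] at h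
  exact h

theorem tree_comm_left :
    tree k (tmul (tmul (tvar b) (tvar a)) (tder α (tder β (tvar c)))) =
      tree k (tmul (tmul (tvar a) (tvar b)) (tder α (tder β (tvar c)))) := by
  have h := congrArg (fun x => (diffOperad k Ω).rename ![a, b, c]
    ((diffOperad k Ω).comp (rfl : 3 + 1 = 3 + 1) 2
      ((diffOperad k Ω).comp (rfl : 2 + 2 = 3 + 1) 0 (mu k Ω) x)
      ((diffOperad k Ω).comp (rfl : 1 + 1 = 1 + 1) 0 (der k α) (der k β)))) (act_swap_mu k (Ω := Ω))
  simp only [mu_eq_ofTree_muTree, der_eq_ofTree_derTree, comp_ofTree, act_ofTree,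
    rename_ofTree] at h
  exact h

theorem tree_comm_right :
    tree k (tmul (tvar a) (tmul (tder β (tvar c)) (tder α (tvar b)))) =
      tree k (tmul (tvar a) (tmul (tder α (tvar b)) (tder β (tvar c)))) := by
  have h := congrArg (fun x => (diffOperad k Ω).rename ![a, b, c]
    ((diffOperad k Ω).comp (rfl : 3 + 1 = 3 + 1) 2
      ((diffOperad k Ω).comp (rfl : 3 + 1 = 3 + 1) 1
        ((diffOperad k Ω).comp (rfl : 2 + 2 = 3 + 1) 1 (mu k Ω) x) (der k α)) (der k β)))
    (act_swap_mu k (Ω := Ω))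
  simp only [mu_eq_ofTree_muTree, der_eq_ofTree_derTree, comp_ofTree, act_ofTree,
    rename_ofTree] at h
  exact h

theorem tree_der_der :
    tree k (tmul (tmul (tvar a) (tvar b)) (tder α (tder β (tvar c)))) =
      tree k (tmul (tmul (tvar a) (tvar b)) (tder β (tder α (tvar c)))) := by
  have h := congrArg (fun x => (diffOperad k Ω).rename ![a, b, c]
    ((diffOperad k Ω).comp (rfl : 3 + 1 = 3 + 1) 2
      ((diffOperad k Ω).comp (rfl : 2 + 2 = 3 + 1) 0 (mu k Ω) (mu k Ω)) x)) (comp_der_der k α β)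
  simp only [mu_eq_ofTree_muTree, der_eq_ofTree_derTree, comp_ofTree, rename_ofTree] at h
  exact h

/-- The image of `a ▷_α (b ▷_β c)`. -/
theorem tree_expand :
    tree k (tmul (tvar a) (tder α (tmul (tvar b) (tder β (tvar c))))) =
      tree k (tmul (tmul (tvar a) (tvar b)) (tder α (tder β (tvar c)))) +
        tree k (tmul (tmul (tvar a) (tder α (tvar b))) (tder β (tvar c))) := by
  rw [tree_leibniz, tree_assoc_der_der, tree_assoc]

/-- Both sides reassociate to a product of `a` with ∂_α b and ∂_β c, in either order. -/
theorem tree_right_comm :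
    tree k (tmul (tmul (tvar a) (tder α (tvar b))) (tder β (tvar c))) =
      tree k (tmul (tmul (tvar a) (tder β (tvar c))) (tder α (tvar b))) := by
  rw [tree_assoc, tree_assoc, tree_comm_right]

end diffOperad

/-- Rewriting the vertices preserves the leaves, so both trees are admissible or both classes are
zero. -/
theorem novHom_tree (k : Type w) [CommRing k] {Ω : Type u} {n : ℕ}
    (t : UBTree (novGens Ω) (Fin n)) :
    (novHom k Ω).app n (freeOperad.tree k t) =
      diffOperad.tree k (t.relabel (novGens.toPre Ω)).pre := by
  by_cases h : t.leaves = Finset.univ.val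
  · refine (congrArg _ (freeOperad.tree_eq_ofTree k h)).trans ((novHom_ofTree k _).trans ?_)
    exact diffOperad.ofTree_eq_tree k _
  · have h' : ¬ (t.relabel (novGens.toPre Ω)).pre.leaves = Finset.univ.val := by
      rwa [UBTree.leaves_pre, UBTree.leaves_relabel]
    rw [diffOperad.tree, freeOperad.tree, dif_neg h, freeOperad.tree, dif_neg h', map_zero]
    exact (map_zero _).symm

/-! ### The multi-Novikov relators as bracketed products, and their images -/

namespace novGens

variable (k : Type w) [CommRing k] {Ω : Type u}

/-- The tree `(a ▷_α b) ▷_β c`. -/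
def triTriTree {X : Type} (α β : Ω) (a b c : X) : UBTree (novGens Ω) X :=
  .bin (W := novGens Ω) (NovGen.tri β)
    (.bin (W := novGens Ω) (NovGen.tri α) (.leaf a) (.leaf b)) (.leaf c)

/-- The tree `a ▷_α (b ▷_β c)`. -/
def triTriTree' {X : Type} (α β : Ω) (a b c : X) : UBTree (novGens Ω) X :=
  .bin (W := novGens Ω) (NovGen.tri α) (.leaf a)
    (.bin (W := novGens Ω) (NovGen.tri β) (.leaf b) (.leaf c))

theorem leaves_triTriTree {X : Type} (α β : Ω) (a b c : X) :
    (triTriTree α β a b c).leaves = {a} + {b} + {c} := rfl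

theorem leaves_triTriTree' {X : Type} (α β : Ω) (a b c : X) :
    (triTriTree' α β a b c).leaves = {a} + {b} + {c} := (add_assoc _ _ _).symm

/-- `(a ▷_α b) ▷_β c` -/
noncomputable def triTri (α β : Ω) (a b c : Fin 3) : (freeOperad k (novGens Ω)).obj 3 :=
  freeOperad.tree k (triTriTree α β a b c)

/-- `a ▷_α (b ▷_β c)` -/
noncomputable def triTri' (α β : Ω) (a b c : Fin 3) : (freeOperad k (novGens Ω)).obj 3 :=
  freeOperad.tree k (triTriTree' α β a b c)

variable (α β : Ω) (a b c : Fin 3)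

/-- This and the next four identities cover every term of the relators. A vertex with a primed
product is turned around by θ(s, t) = θ'(t, s), after which only the two bracketings of unprimed
products remain. -/
theorem circI_tri_tri : (freeOperad k (novGens Ω)).circI (tri k β) (tri k α) =
    triTri k α β 0 1 2 :=
  (freeOperad.circI_bin k _ _).trans (freeOperad.ofTree_eq_tree k _)

theorem circI_tri_tri' : (freeOperad k (novGens Ω)).circI (tri k β) (tri' k α) =
    triTri k α β 1 0 2 :=
  (freeOperad.circI_bin k _ _).trans ((freeOperad.ofTree_eq_tree k _).trans
    (freeOperad.tree_swap_inner k _ _ _ _ _))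

theorem circIII_tri_tri' : (freeOperad k (novGens Ω)).circIII (tri k β) (tri' k α) =
    triTri k α β 0 2 1 :=
  (freeOperad.circIII_bin k _ _).trans ((freeOperad.ofTree_eq_tree k _).trans
    (freeOperad.tree_swap_inner k _ _ _ _ _))

theorem circII_tri'_tri : (freeOperad k (novGens Ω)).circII (tri' k α) (tri k β) =
    triTri' k α β 0 1 2 :=
  (freeOperad.circII_bin k _ _).trans ((freeOperad.ofTree_eq_tree k _).trans
    (freeOperad.tree_swap k _ _ _ _ _))

theorem circIII_tri'_tri' : (freeOperad k (novGens Ω)).circIII (tri' k α) (tri' k β) =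
    triTri' k α β 1 0 2 :=
  (freeOperad.circIII_bin k _ _).trans ((freeOperad.ofTree_eq_tree k _).trans
    ((freeOperad.tree_swap_inner k _ _ _ _ _).trans (freeOperad.tree_swap k _ _ _ _ _)))

theorem novHom_triTri : (novHom k Ω).app 3 (triTri k α β a b c) =
    diffOperad.tree k (.bin () (.bin () (.leaf a) (.un (W := diffGens Ω) α (.leaf b)))
      (.un (W := diffGens Ω) β (.leaf c))) :=
  novHom_tree k _

theorem novHom_triTri' : (novHom k Ω).app 3 (triTri' k α β a b c) =
    diffOperad.tree k (.bin () (.leaf a) (.un (W := diffGens Ω) α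
      (.bin () (.leaf b) (.un (W := diffGens Ω) β (.leaf c))))) :=
  novHom_tree k _

/-- One of the two Leibniz terms of a ∂_α(b ∂_β c) cancels the image of (a ▷_α b) ▷_β c. The
remaining term is visibly symmetric in `a`, `b` and in `α`, `β`, which explains the first two
families of relators. -/
theorem novHom_assoc : (novHom k Ω).app 3 (triTri k α β a b c - triTri' k α β a b c) =
    -diffOperad.tree k (.bin () (.bin () (.leaf a) (.leaf b))
      (.un (W := diffGens Ω) α (.un (W := diffGens Ω) β (.leaf c)))) := by
  rw [map_sub, novHom_triTri, novHom_triTri', diffOperad.tree_expand]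
  abel

end novGens

open novGens in
-- The kernel is stable under permutations, so it suffices to treat the three families. They express
-- the symmetries ab = ba, ∂_α∂_β = ∂_β∂_α and the commutation of the factors ∂_α(b) and ∂_β(c).
theorem novRel_le_ker_novHom (k : Type w) [CommRing k] (Ω : Type u) :
    novRel k Ω ≤ (novHom k Ω).ker.carrier 3 := by
  refine Submodule.span_le.2 ?_
  rintro _ ⟨σ, r, hr, rfl⟩
  refine (novHom k Ω).ker.act_mem σ (LinearMap.mem_ker.2 ?_)
  cases hr with
  | left α β =>
    rw [circI_tri_tri, circII_tri'_tri, circI_tri_tri', circIII_tri'_tri', sub_add, map_sub,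
      novHom_assoc, novHom_assoc, diffOperad.tree_comm_left, sub_self]
  | exchange α β =>
    rw [circI_tri_tri, circII_tri'_tri, circI_tri_tri, circII_tri'_tri, sub_add, map_sub,
      novHom_assoc, novHom_assoc, diffOperad.tree_der_der, sub_self]
  | right α β =>
    rw [circI_tri_tri, circIII_tri_tri', map_sub, novHom_triTri, novHom_triTri,
      diffOperad.tree_right_comm, sub_self]

/-! ### Trees without unary vertices of arity at most three -/

namespace UBTree

variable {W : UBGens.{u, v}} {X : Type}

theorem card_leaves_pos (t : UBTree W X) : 0 < t.leaves.card :=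
  Multiset.card_pos.2 t.leaves_ne_zero

theorem exists_eq_leaf [IsEmpty W.un] (t : UBTree W X) (h : t.leaves.card = 1) :
    ∃ x, t = leaf x := by
  cases t with
  | leaf x => exact ⟨x, rfl⟩
  | un ω t => exact isEmptyElim ω
  | bin θ s t =>
    rw [leaves, Multiset.card_add] at h
    have := s.card_leaves_pos
    have := t.card_leaves_pos
    omega

theorem exists_eq_bin [IsEmpty W.un] (t : UBTree W X) (h : t.leaves.card = 2) :
    ∃ θ a b, t = bin θ (leaf a) (leaf b) := by
  cases t with
  | leaf x => simp [leaves] at h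
  | un ω t => exact isEmptyElim ω
  | bin θ s t =>
    rw [leaves, Multiset.card_add] at h
    have := s.card_leaves_pos
    have := t.card_leaves_pos
    obtain ⟨a, rfl⟩ := s.exists_eq_leaf (by omega)
    obtain ⟨b, rfl⟩ := t.exists_eq_leaf (by omega)
    exact ⟨θ, a, b, rfl⟩

theorem exists_eq_bin_bin [IsEmpty W.un] (t : UBTree W X) (h : t.leaves.card = 3) :
    ∃ θ η a b c, t = bin θ (bin η (leaf a) (leaf b)) (leaf c) ∨
      t = bin θ (leaf a) (bin η (leaf b) (leaf c)) := by
  cases t with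
  | leaf x => simp [leaves] at h
  | un ω t => exact isEmptyElim ω
  | bin θ s t =>
    rw [leaves, Multiset.card_add] at h
    have := s.card_leaves_pos
    have := t.card_leaves_pos
    obtain hs | hs : s.leaves.card = 1 ∨ s.leaves.card = 2 := by omega
    · obtain ⟨a, rfl⟩ := s.exists_eq_leaf hs
      obtain ⟨η, b, c, rfl⟩ := t.exists_eq_bin (by omega)
      exact ⟨θ, η, a, b, c, Or.inr rfl⟩
    · obtain ⟨η, a, b, rfl⟩ := s.exists_eq_bin hs
      obtain ⟨c, rfl⟩ := t.exists_eq_leaf (by omega)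
      exact ⟨θ, η, a, b, c, Or.inl rfl⟩

end UBTree

instance (Ω : Type u) : IsEmpty (novGens Ω).un := inferInstanceAs (IsEmpty Empty)

/-- A symmetric function of two indices is the restriction of a linear map to
products of two variables. -/
theorem MvPolynomial.exists_linearMap_X_mul_X {k : Type w} [CommRing k] {ι : Type u} {M : Type v}
    [AddCommGroup M] [Module k M] (v : ι → ι → M) (hv : ∀ p q, v p q = v q p) :
    ∃ F : MvPolynomial ι k →ₗ[k] M, ∀ p q, F (X p * X q) = v p q := by
  classical
  -- On monomials of degree two the value is read off from a chosen pair of indices; all other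
  -- monomials go to zero.
  let g : (ι →₀ ℕ) → M := fun m =>
    if h : ∃ z : ι × ι, m = Finsupp.single z.1 1 + Finsupp.single z.2 1 then
      v h.choose.1 h.choose.2 else 0
  refine ⟨(basisMonomials ι k).constr k g, fun p q => ?_⟩
  have hm : (X p * X q : MvPolynomial ι k) =
      basisMonomials ι k (Finsupp.single p 1 + Finsupp.single q 1) := by
    simp [X, monomial_mul]
  rw [hm, Module.Basis.constr_basis]
  have h : ∃ z : ι × ι, (Finsupp.single p 1 + Finsupp.single q 1 : ι →₀ ℕ) =
      Finsupp.single z.1 1 + Finsupp.single z.2 1 := ⟨(p, q), rfl⟩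
  rw [show g _ = v h.choose.1 h.choose.2 from dif_pos h]
  have hz := h.choose_spec
  generalize h.choose = z at hz
  -- The chosen pair is (p, q) or (q, p), and `hv` makes the choice harmless. The third case would
  -- require 1 + 1 = 0 in ℕ.
  rcases (Finsupp.single_add_single_eq_single_add_single one_ne_zero one_ne_zero).1 hz with
    ⟨h1, h2⟩ | ⟨-, h1, h2⟩ | ⟨h0, -, -⟩
  · rw [← h1, ← h2]
  · rw [← h1, ← h2, hv]
  · omega

/-! ### Stability of the relators under permutation and relabelling -/

namespace Operad

variable {k : Type w} [CommRing k] (P : Operad.{w, w'} k)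

theorem act_mem_symSpan {n : ℕ} (S : Set (P.obj n)) (σ : Perm (Fin n)) {x : P.obj n}
    (hx : x ∈ P.symSpan S) : P.act σ x ∈ P.symSpan S := by
  have h : P.symSpan S ≤ (P.symSpan S).comap (P.act σ) := by
    refine Submodule.span_le.2 ?_
    rintro _ ⟨τ, r, hr, rfl⟩
    rw [SetLike.mem_coe, Submodule.mem_comap, ← P.act_mul]
    exact Submodule.subset_span ⟨τ * σ, r, hr, rfl⟩
  exact h hx

theorem rename_mem_symSpan {n : ℕ} (S : Set (P.obj n)) (f : Fin n → Fin n) {x : P.obj n}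
    (hx : x ∈ P.symSpan S) : P.rename f x ∈ P.symSpan S := by
  unfold rename
  split_ifs
  · exact P.act_mem_symSpan S _ hx
  · exact zero_mem _

end Operad

/-- The three residues modulo 3 sum to zero, so two of them determine the third. This provides the
missing label in `classOfSymbol`. -/
theorem Fin.ne_and_neg_add_eq_of_labels {a b c : Fin 3}
    (h : ({a} + {b} + {c} : Multiset _) = Finset.univ.val) : b ≠ c ∧ -(b + c) = a := by
  decide +revert

theorem Fin.add_one_add_two_of_labels {a b c : Fin 3}
    (h : ({a} + {b} + {c} : Multiset _) = Finset.univ.val) :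
    (c + 1 = a ∧ c + 2 = b) ∨ (c + 1 = b ∧ c + 2 = a) := by
  decide +revert

/-! ### Recovering an operation from its symbol modulo the relators -/

namespace novGens

variable (k : Type w) [CommRing k] {Ω : Type u} (α β : Ω) {a b c : Fin 3}

theorem rename_triTri (f : Fin 3 → Fin 3) (h : ({a} + {b} + {c} : Multiset _) = Finset.univ.val) :
    (freeOperad k (novGens Ω)).rename f (triTri k α β a b c) =
      triTri k α β (f a) (f b) (f c) :=
  (congrArg _ (freeOperad.tree_eq_ofTree k ((leaves_triTriTree α β a b c).trans h))).trans
    (freeOperad.rename_ofTree k f _)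

theorem rename_triTri' (f : Fin 3 → Fin 3) (h : ({a} + {b} + {c} : Multiset _) = Finset.univ.val) :
    (freeOperad k (novGens Ω)).rename f (triTri' k α β a b c) =
      triTri' k α β (f a) (f b) (f c) :=
  (congrArg _ (freeOperad.tree_eq_ofTree k ((leaves_triTriTree' α β a b c).trans h))).trans
    (freeOperad.rename_ofTree k f _)

variable (a b c)

theorem triTri_right_mem :
    triTri k α β a b c - triTri k β α a c b ∈ novRel k Ω := by
  have h := (freeOperad k (novGens Ω)).rename_mem_symSpan _ ![a, b, c]
    (Submodule.subset_span ⟨1, _, NovRelator.right (k := k) α β, rfl⟩)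
  rw [Operad.act_one, circI_tri_tri, circIII_tri_tri', map_sub, rename_triTri k _ _ _ (by decide),
    rename_triTri k _ _ _ (by decide)] at h
  exact h

theorem assoc_left_mem :
    (triTri k α β a b c - triTri' k α β a b c) - (triTri k α β b a c - triTri' k α β b a c) ∈
      novRel k Ω := by
  have h := (freeOperad k (novGens Ω)).rename_mem_symSpan _ ![a, b, c]
    (Submodule.subset_span ⟨1, _, NovRelator.left (k := k) α β, rfl⟩)
  rw [Operad.act_one, circI_tri_tri, circII_tri'_tri, circI_tri_tri', circIII_tri'_tri', sub_add,
    map_sub, map_sub, map_sub, rename_triTri k _ _ _ (by decide),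
    rename_triTri k _ _ _ (by decide), rename_triTri' k _ _ _ (by decide),
    rename_triTri' k _ _ _ (by decide)] at h
  exact h

theorem assoc_exchange_mem :
    (triTri k α β a b c - triTri' k α β a b c) - (triTri k β α a b c - triTri' k β α a b c) ∈
      novRel k Ω := by
  have h := (freeOperad k (novGens Ω)).rename_mem_symSpan _ ![a, b, c]
    (Submodule.subset_span ⟨1, _, NovRelator.exchange (k := k) α β, rfl⟩)
  rw [Operad.act_one, circI_tri_tri, circII_tri'_tri, circI_tri_tri, circII_tri'_tri, sub_add,
    map_sub, map_sub, map_sub, rename_triTri k _ _ _ (by decide),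
    rename_triTri k _ _ _ (by decide), rename_triTri' k _ _ _ (by decide),
    rename_triTri' k _ _ _ (by decide)] at h
  exact h

/-- Every primed vertex becomes unprimed when its two subtrees are interchanged. The cases are the
two bracketings with two kinds of product at each vertex. -/
theorem exists_tree_eq (t : UBTree (novGens Ω) (Fin 3)) (h : t.leaves = Finset.univ.val) :
    ∃ α β a b c, ({a} + {b} + {c} : Multiset _) = Finset.univ.val ∧
      (freeOperad.tree k t = triTri k α β a b c ∨ freeOperad.tree k t = triTri' k α β a b c) := by
  obtain ⟨θ, η, a, b, c, rfl | rfl⟩ := t.exists_eq_bin_bin (by rw [h]; rfl)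
  · rcases θ with β | α <;> rcases η with γ | γ
    · exact ⟨γ, β, a, b, c, h, Or.inl rfl⟩
    · exact ⟨γ, β, b, a, c, (by rw [← h]; simp only [UBTree.leaves]; abel),
        Or.inl (freeOperad.tree_swap_inner k _ _ _ _ _)⟩
    · exact ⟨α, γ, c, a, b, (by rw [← h]; simp only [UBTree.leaves]; abel),
        Or.inr (freeOperad.tree_swap k _ _ _ _ _)⟩
    · exact ⟨α, γ, c, b, a, (by rw [← h]; simp only [UBTree.leaves]; abel),
        Or.inr ((freeOperad.tree_swap_inner k _ _ _ _ _).trans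
          (freeOperad.tree_swap k _ _ _ _ _))⟩
  · rcases θ with α | β <;> rcases η with γ | γ
    · exact ⟨α, γ, a, b, c, (by rw [← h]; simp only [UBTree.leaves]; abel), Or.inr rfl⟩
    · exact ⟨α, γ, a, c, b, (by rw [← h]; simp only [UBTree.leaves]; abel),
        -- The inner interchange is available only for trees bracketed to the left, so the root is
        -- turned around first and turned back afterwards.
        Or.inr ((freeOperad.tree_swap k (W := novGens Ω) (NovGen.tri' α) (NovGen.tri' γ) b c a).symm.trans
          ((freeOperad.tree_swap_inner k _ _ _ _ _).trans (freeOperad.tree_swap k _ _ _ _ _)))⟩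
    · exact ⟨γ, β, b, c, a, (by rw [← h]; simp only [UBTree.leaves]; abel),
        Or.inl (freeOperad.tree_swap k (W := novGens Ω) (NovGen.tri β) (NovGen.tri γ) b c a).symm⟩
    · exact ⟨γ, β, c, b, a, (by rw [← h]; simp only [UBTree.leaves]; abel),
        Or.inl ((freeOperad.tree_swap k (W := novGens Ω) (NovGen.tri β) (NovGen.tri' γ) b c a).symm.trans
          (freeOperad.tree_swap_inner k _ _ _ _ _))⟩

/-- The symbol of a ternary operation in the images of `▷_ω`, `▷'_ω`, with generic weights. -/
noncomputable def symbolMap (k : Type w) [CommRing k] (Ω : Type u) :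
    (freeOperad k (novGens Ω)).obj 3 →ₗ[k] MvPolynomial (Fin 3 × Ω) k :=
  ((diffSymbols k Ω (MvPolynomial (Fin 3 × Ω) k)).app 3 fun i ω => MvPolynomial.X (i, ω)).comp
    ((novHom k Ω).app 3)

theorem symbolMap_tree (t : UBTree (novGens Ω) (Fin 3)) (h : t.leaves = Finset.univ.val) :
    symbolMap k Ω (freeOperad.tree k t) =
      (t.relabel (toPre Ω)).pre.symbol fun i ω => MvPolynomial.X (i, ω) := by
  refine (congrArg (symbolMap k Ω) (freeOperad.tree_eq_ofTree k h)).trans ?_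
  refine (congrArg ((diffSymbols k Ω (MvPolynomial (Fin 3 × Ω) k)).app 3 _)
    (novHom_ofTree k _)).trans ?_
  exact diffSymbols_ofTree k Ω _ _ _

variable {a b c}

theorem symbolMap_triTri (h : ({a} + {b} + {c} : Multiset _) = Finset.univ.val) :
    symbolMap k Ω (triTri k α β a b c) = MvPolynomial.X (b, α) * MvPolynomial.X (c, β) := by
  refine (symbolMap_tree k _ ((leaves_triTriTree α β a b c).trans h)).trans ?_
  change 1 * (MvPolynomial.X (b, α) * 1) * (MvPolynomial.X (c, β) * 1) = _
  ring

/-- The outer derivation acts on the product of b and ∂_β c, hence sees the sum of the weights of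
`b` and `c`. -/
theorem symbolMap_triTri' (h : ({a} + {b} + {c} : Multiset _) = Finset.univ.val) :
    symbolMap k Ω (triTri' k α β a b c) =
      MvPolynomial.X (b, α) * MvPolynomial.X (c, β) +
        MvPolynomial.X (c, α) * MvPolynomial.X (c, β) := by
  refine (symbolMap_tree k _ ((leaves_triTriTree' α β a b c).trans h)).trans ?_
  change 1 * ((MvPolynomial.X (b, α) + MvPolynomial.X (c, α)) *
    (1 * (MvPolynomial.X (c, β) * 1))) = _
  ring

/-- The class modulo the multi-Novikov relators of the operation with symbol `X p * X q`. -/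
noncomputable def classOfSymbol (p q : Fin 3 × Ω) :
    (freeOperad k (novGens Ω)).obj 3 ⧸ novRel k Ω :=
  -- Two derivations on the same input come from an associator, up to sign; the other two labels are
  -- listed cyclically, an arbitrary choice. For distinct inputs, `-(p.1 + q.1)` is the remaining
  -- label.
  if p.1 = q.1 then
    -(novRel k Ω).mkQ (triTri k p.2 q.2 (p.1 + 1) (p.1 + 2) p.1 -
      triTri' k p.2 q.2 (p.1 + 1) (p.1 + 2) p.1)
  else (novRel k Ω).mkQ (triTri k p.2 q.2 (-(p.1 + q.1)) p.1 q.1)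

/-- Needed because the two variables commute. For equal inputs it is the exchange relator, for
distinct inputs the right-commutativity relator. -/
theorem classOfSymbol_comm (p q : Fin 3 × Ω) : classOfSymbol k p q = classOfSymbol k q p := by
  obtain ⟨i, α⟩ := p
  obtain ⟨j, β⟩ := q
  by_cases h : i = j
  · subst h
    simp only [classOfSymbol, if_true]
    exact congrArg Neg.neg ((Submodule.Quotient.eq _).2 (assoc_exchange_mem k α β _ _ _))
  · simp only [classOfSymbol, if_neg h, if_neg (Ne.symm h), add_comm j i]
    exact (Submodule.Quotient.eq _).2 (triTri_right_mem k α β _ _ _)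

theorem classOfSymbol_of_ne (h : ({a} + {b} + {c} : Multiset (Fin 3)) = Finset.univ.val) :
    classOfSymbol k (b, α) (c, β) = (novRel k Ω).mkQ (triTri k α β a b c) := by
  have h' := Fin.ne_and_neg_add_eq_of_labels h
  simp only [classOfSymbol, if_neg h'.1, h'.2]

/-- The labels `a`, `b` may appear in the order opposite to the cyclic one chosen in the definition;
left symmetry of the associator then identifies the two classes. -/
theorem classOfSymbol_self (h : ({a} + {b} + {c} : Multiset (Fin 3)) = Finset.univ.val) :
    classOfSymbol k (c, α) (c, β) =
      -(novRel k Ω).mkQ (triTri k α β a b c - triTri' k α β a b c) := by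
  have h' := Fin.add_one_add_two_of_labels h
  simp only [classOfSymbol, if_true]
  rcases h' with ⟨h1, h2⟩ | ⟨h1, h2⟩
  · rw [h1, h2]
  · rw [h1, h2]
    exact congrArg Neg.neg ((Submodule.Quotient.eq _).2 (assoc_left_mem k α β _ _ _))

/-- The symbol determines the class modulo the relators: a linear map `F` on polynomials satisfies F
∘ symbol = quotient map, which has to be checked only on the two bracketings. -/
theorem ker_symbolMap_le : LinearMap.ker (symbolMap k Ω) ≤ novRel k Ω := by
  obtain ⟨F, hF⟩ := MvPolynomial.exists_linearMap_X_mul_X (k := k) (classOfSymbol k (Ω := Ω))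
    (classOfSymbol_comm k)
  have key : F.comp (symbolMap k Ω) = (novRel k Ω).mkQ := by
    refine freeOperad.linearMap_ext fun t => ?_
    rw [freeOperad.ofTree_eq_tree, LinearMap.comp_apply]
    obtain ⟨α, β, a, b, c, h, ht | ht⟩ := exists_tree_eq k t.1 t.2
    · rw [ht, symbolMap_triTri k α β h, hF, classOfSymbol_of_ne k α β h]
    -- The two monomials give the class of (a ▷_α b) ▷_β c minus the class of the associator, which
    -- is that of a ▷_α (b ▷_β c).
    · rw [ht, symbolMap_triTri' k α β h, map_add, hF, hF, classOfSymbol_of_ne k α β h,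
        classOfSymbol_self k α β h, map_sub]
      abel
  intro x hx
  rw [← (novRel k Ω).ker_mkQ, ← key, LinearMap.mem_ker, LinearMap.comp_apply,
    LinearMap.mem_ker.1 hx, map_zero]

end novGens

/-- The symbol factors through `novHom`, so the kernel of `novHom` lies between the relators and the
kernel of the symbol, which is contained in the relators. -/
theorem ker_novHom (k : Type w) [CommRing k] (Ω : Type u) :
    (novHom k Ω).ker.carrier 3 = novRel k Ω := by
  refine le_antisymm (fun x hx => novGens.ker_symbolMap_le k ?_) (novRel_le_ker_novHom k Ω)
  have hx' : (novHom k Ω).app 3 x = 0 := hx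
  rw [LinearMap.mem_ker, novGens.symbolMap, LinearMap.comp_apply, hx', map_zero]

/-! ### Quadratic elements -/

namespace Operad

variable {k : Type w} [CommRing k] (P : Operad.{w, w'} k)

theorem innerPerm_swap : innerPerm (rfl : 2 + 2 = 3 + 1) 0 (swap 0 1) = swap 0 1 := by
  have h0 := innerPerm_inner (rfl : 2 + 2 = 3 + 1) 0 (swap 0 1) 0
  have h1 := innerPerm_inner (rfl : 2 + 2 = 3 + 1) 0 (swap 0 1) 1
  have h2 := innerPerm_outer (rfl : 2 + 2 = 3 + 1) 0 (swap 0 1) 1 (by decide)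
  refine Equiv.ext fun x => ?_
  fin_cases x
  · exact h0.trans (by decide)
  · exact h1.trans (by decide)
  · exact h2.trans (by decide)

theorem act_swap_circI (μ ν : P.obj 2) :
    P.act (swap 0 1) (P.circI μ ν) = P.circI μ (P.act (swap 0 1) ν) := by
  rw [circI, circI, comp_act, innerPerm_swap]

theorem act_circI_mem_quadraticPart (σ : Perm (Fin 3)) (μ ν : P.obj 2) :
    P.act σ (P.circI μ ν) ∈ P.quadraticPart := by
  have rot : ∀ (τ : Perm (Fin 3)), τ = 1 ∨ τ = (finRotate 3)⁻¹ ∨ τ = finRotate 3 →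
      ∀ ν, P.act τ (P.circI μ ν) ∈ P.quadraticPart := by
    rintro τ (rfl | rfl | rfl) ν <;> refine Submodule.subset_span ⟨μ, ν, ?_⟩
    · exact Or.inl (P.act_one _)
    · exact Or.inr (Or.inl rfl)
    · exact Or.inr (Or.inr rfl)
  -- Every permutation is a rotation, possibly preceded by the transposition of the inputs of ν.
  -- That transposition is absorbed into ν, and the rotations give the three types of composition.
  have hσ : ∃ τ : Perm (Fin 3), (τ = 1 ∨ τ = (finRotate 3)⁻¹ ∨ τ = finRotate 3) ∧
      (σ = τ ∨ σ = swap 0 1 * τ) := by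
    decide +revert
  obtain ⟨τ, hτ, rfl | rfl⟩ := hσ
  · exact rot σ hτ ν
  · rw [P.act_mul, act_swap_circI]
    exact rot τ hτ _

theorem circI_mem_quadraticPart (μ ν : P.obj 2) : P.circI μ ν ∈ P.quadraticPart :=
  Submodule.subset_span ⟨μ, ν, Or.inl rfl⟩

theorem circII_mem_quadraticPart (μ ν : P.obj 2) : P.circII μ ν ∈ P.quadraticPart :=
  Submodule.subset_span ⟨μ, ν, Or.inr (Or.inl rfl)⟩

theorem circIII_mem_quadraticPart (μ ν : P.obj 2) : P.circIII μ ν ∈ P.quadraticPart :=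
  Submodule.subset_span ⟨μ, ν, Or.inr (Or.inr rfl)⟩

theorem act_mem_quadraticPart (σ : Perm (Fin 3)) {x : P.obj 3} (hx : x ∈ P.quadraticPart) :
    P.act σ x ∈ P.quadraticPart := by
  have h : P.quadraticPart ≤ P.quadraticPart.comap (P.act σ) := by
    refine Submodule.span_le.2 ?_
    rintro _ ⟨μ, ν, rfl | rfl | rfl⟩
    · exact P.act_circI_mem_quadraticPart σ μ ν
    · rw [SetLike.mem_coe, Submodule.mem_comap, circII, ← P.act_mul]
      exact P.act_circI_mem_quadraticPart _ μ ν
    · rw [SetLike.mem_coe, Submodule.mem_comap, circIII, ← P.act_mul]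
      exact P.act_circI_mem_quadraticPart _ μ ν
  exact h hx

/-- A morphism is determined on quadratic elements by its values on binary operations. -/
theorem Hom.eq_on_quadraticPart {P : Operad.{w, w'} k} {Q : Operad.{w, w''} k} {F G : Hom P Q}
    (h : F.app 2 = G.app 2) {x : P.obj 3} (hx : x ∈ P.quadraticPart) :
    F.app 3 x = G.app 3 x := by
  have hI : ∀ μ ν, F.app 3 (P.circI μ ν) = G.app 3 (P.circI μ ν) := fun μ ν => by
    rw [circI, F.map_comp, G.map_comp, h]
  refine LinearMap.eqOn_span (R := k) (f := F.app 3) (g := G.app 3) ?_ hx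
  rintro _ ⟨μ, ν, rfl | rfl | rfl⟩
  · exact hI μ ν
  · rw [circII, F.map_act, G.map_act, hI]
  · rw [circIII, F.map_act, G.map_act, hI]

end Operad

/-- A linear map on the binary operations of a free operad without unary generators is determined by
its values on the generators. -/
theorem freeOperad.linearMap_ext_two {k : Type w} [CommRing k] {W : UBGens.{u, v}} [IsEmpty W.un]
    {M : Type w'} [AddCommGroup M] [Module k M] {f g : (freeOperad k W).obj 2 →ₗ[k] M}
    (h : ∀ θ, f (freeOperad.bin k θ) = g (freeOperad.bin k θ)) : f = g := by
  refine freeOperad.linearMap_ext fun ⟨t, ht⟩ => ?_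
  obtain ⟨θ, a, b, rfl⟩ := t.exists_eq_bin (by rw [ht]; rfl)
  have hab : (a = 0 ∧ b = 1) ∨ (a = 1 ∧ b = 0) := by
    have ht' : ({a} + {b} : Multiset (Fin 2)) = Finset.univ.val := ht
    clear ht
    revert ht'
    revert a b
    decide
  rcases hab with ⟨rfl, rfl⟩ | ⟨rfl, rfl⟩
  · exact h θ
  · have hop : freeOperad.ofTree k ⟨.bin θ (.leaf 1) (.leaf 0), ht⟩ =
        freeOperad.bin k (W.op θ) :=
      (freeOperad.act_ofTree k (swap 0 1) (TreeMonomial.binTree θ)).symm.trans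
        (freeOperad.act_bin k θ)
    exact (congrArg f hop).trans ((h _).trans (congrArg g hop).symm)

open novGens in
theorem novRel_le_quadraticPart (k : Type w) [CommRing k] (Ω : Type u) :
    novRel k Ω ≤ (freeOperad k (novGens Ω)).quadraticPart := by
  refine Submodule.span_le.2 ?_
  rintro _ ⟨σ, r, hr, rfl⟩
  refine Operad.act_mem_quadraticPart _ σ ?_
  have hI := (freeOperad k (novGens Ω)).circI_mem_quadraticPart
  have hII := (freeOperad k (novGens Ω)).circII_mem_quadraticPart
  have hIII := (freeOperad k (novGens Ω)).circIII_mem_quadraticPart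
  cases hr with
  | left α β => exact add_mem (sub_mem (sub_mem (hI _ _) (hII _ _)) (hI _ _)) (hIII _ _)
  | exchange α β => exact add_mem (sub_mem (sub_mem (hI _ _) (hII _ _)) (hI _ _)) (hII _ _)
  | right α β => exact sub_mem (hI _ _) (hIII _ _)

theorem IsNovInduced.app_two_eq {k : Type w} [CommRing k] {Ω : Type u}
    {Φ Ψ : Operad.Hom (freeOperad k (novGens Ω)) (diffOperad k Ω)} (hΦ : IsNovInduced Φ)
    (hΨ : IsNovInduced Ψ) : Φ.app 2 = Ψ.app 2 := by
  refine freeOperad.linearMap_ext_two ?_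
  rintro (ω | ω)
  · exact (hΦ ω).1.trans (hΨ ω).1.symm
  · exact (hΦ ω).2.trans (hΨ ω).2.symm

/-- On quadratic elements Φ coincides with `novHom`, since both agree in arity two. The relators are
themselves quadratic, so the intersection is the kernel of `novHom` in arity three. -/
theorem IsNovInduced.ker_inf_quadraticPart {k : Type w} [CommRing k] {Ω : Type u}
    {Φ : Operad.Hom (freeOperad k (novGens Ω)) (diffOperad k Ω)} (hΦ : IsNovInduced Φ) :
    Φ.ker.carrier 3 ⊓ (freeOperad k (novGens Ω)).quadraticPart = novRel k Ω := by
  have h := hΦ.app_two_eq (isNovInduced_novHom k Ω)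
  rw [← ker_novHom]
  refine le_antisymm ?_ (le_inf ?_ ?_)
  · rintro x ⟨hx, hq⟩
    exact (Operad.Hom.eq_on_quadraticPart h hq).symm.trans hx
  · intro x hx
    have hq := novRel_le_quadraticPart k Ω (ker_novHom k Ω ▸ hx)
    exact (Operad.Hom.eq_on_quadraticPart h hq).trans hx
  · rw [ker_novHom]
    exact novRel_le_quadraticPart k Ω

/-! ### The isomorphism with the pre-induced operad -/

/-- Mutually inverse morphisms that exchange two sets of relators of arity `n` induce an isomorphism
of the quotients. -/
def Operad.isoOfRelators {k : Type w} [CommRing k] {P : Operad.{w, w'} k} {Q : Operad.{w, w''} k}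
    (F : Hom P Q) (G : Hom Q P) (hGF : ∀ n x, G.app n (F.app n x) = x)
    (hFG : ∀ n y, F.app n (G.app n y) = y) {m : ℕ} (S : Set (P.obj m)) (T : Set (Q.obj m))
    (hF : ∀ x ∈ S, F.app m x ∈ T) (hG : ∀ y ∈ T, G.app m y ∈ S) :
    Iso (P.quotient (P.idealSpan (AtArity P m S))) (Q.quotient (Q.idealSpan (AtArity Q m T))) :=
  have hF' : ∀ n, (P.idealSpan (AtArity P m S)).carrier n ≤
      (F.trans (Q.proj (Q.idealSpan (AtArity Q m T)))).ker.carrier n := by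
    refine P.idealSpan_le _ _ ?_
    rintro _ _ ⟨x, hx⟩
    exact (Submodule.Quotient.mk_eq_zero _).2
      (Q.subset_idealSpan (AtArity Q _ T) _ (AtArity.mk _ (hF x hx)))
  have hG' : ∀ n, (Q.idealSpan (AtArity Q m T)).carrier n ≤
      (G.trans (P.proj (P.idealSpan (AtArity P m S)))).ker.carrier n := by
    refine Q.idealSpan_le _ _ ?_
    rintro _ _ ⟨y, hy⟩
    exact (Submodule.Quotient.mk_eq_zero _).2
      (P.subset_idealSpan (AtArity P _ S) _ (AtArity.mk _ (hG y hy)))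
  { (F.trans (Q.proj (Q.idealSpan (AtArity Q m T)))).lift _ hF' with
    bijective := fun n => by
      refine Function.bijective_iff_has_inverse.2
        ⟨((G.trans (P.proj (P.idealSpan (AtArity P m S)))).lift _ hG').app n, ?_, ?_⟩
      · rintro ⟨x⟩
        exact congrArg (Submodule.mkQ _) (hGF n x)
      · rintro ⟨y⟩
        exact congrArg (Submodule.mkQ _) (hFG n y) }

theorem toPre_mem_preRel (k : Type w) [CommRing k] (Ω : Type u) :
    ∀ x ∈ novRel k Ω,
      (freeMapHom k (novGens.toPre Ω)).app 3 x ∈ preRel k (diffGens Ω) (DiffRel k Ω) :=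
  fun _ hx => novRel_le_ker_novHom k Ω hx

/-- As `novHom` is `toPre` followed by the pre-induced morphism Φ, its value at the image of y under
`ofPre` is Φ(y) = 0, and the kernel of `novHom` is known. -/
theorem ofPre_mem_novRel (k : Type w) [CommRing k] (Ω : Type u) :
    ∀ y ∈ preRel k (diffGens Ω) (DiffRel k Ω),
      (freeMapHom k (novGens.ofPre Ω)).app 3 y ∈ novRel k Ω := by
  intro y hy
  rw [← ker_novHom]
  refine (congrArg ((preHom k (diffGens Ω) (DiffRel k Ω)).app 3)
    (novGens.toPre_ofPre k y)).trans hy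

/-- The isomorphism with `▷_ω ↦ ≺_{ω,μ}` and `▷'_ω ↦ ≻_{ω,μ}`. -/
noncomputable def novOperadIso (k : Type w) [CommRing k] (Ω : Type u) :
    Operad.Iso (novOperad k Ω) (preDiffOperad k Ω) :=
  have hF : ∀ x ∈ (novRel k Ω : Set ((freeOperad k (novGens Ω)).obj 3)),
      (freeMapHom k (novGens.toPre Ω)).app 3 x ∈ (preRel k (diffGens Ω) (DiffRel k Ω) : Set _) :=
    toPre_mem_preRel k Ω
  have hG : ∀ y ∈ (preRel k (diffGens Ω) (DiffRel k Ω) : Set _),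
      (freeMapHom k (novGens.ofPre Ω)).app 3 y ∈ (novRel k Ω : Set _) :=
    ofPre_mem_novRel k Ω
  Operad.isoOfRelators (freeMapHom k (novGens.toPre Ω)) (freeMapHom k (novGens.ofPre Ω))
    (fun _ x => novGens.ofPre_toPre k x) (fun _ y => novGens.toPre_ofPre k y) _ _ hF hG

theorem novOperadIso_tri (k : Type w) [CommRing k] {Ω : Type u} (ω : Ω) :
    (novOperadIso k Ω).app 2 (novOperad.tri k ω) = preDiffOperad.prec k ω :=
  congrArg (Submodule.mkQ _) (freeMapHom_ofTree k (novGens.toPre Ω) _)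

theorem novOperadIso_tri' (k : Type w) [CommRing k] {Ω : Type u} (ω : Ω) :
    (novOperadIso k Ω).app 2 (novOperad.tri' k ω) = preDiffOperad.succ k ω :=
  congrArg (Submodule.mkQ _) (freeMapHom_ofTree k (novGens.toPre Ω) _)

theorem theorem3p3 (k : Type w) [Field k] (Ω : Type u) :
    (∃ e : Operad.Iso (novOperad k Ω) (preDiffOperad k Ω), ∀ ω : Ω,
      e.app 2 (novOperad.tri k ω) = preDiffOperad.prec k ω ∧
      e.app 2 (novOperad.tri' k ω) = preDiffOperad.succ k ω) ∧
    (∃ Φ : Operad.Hom (freeOperad k (novGens Ω)) (diffOperad k Ω), IsNovInduced Φ) ∧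
    (∀ Φ : Operad.Hom (freeOperad k (novGens Ω)) (diffOperad k Ω), IsNovInduced Φ →
      Φ.ker.carrier 3 ⊓ (freeOperad k (novGens Ω)).quadraticPart = novRel k Ω) :=
  ⟨⟨novOperadIso k Ω, fun ω => ⟨novOperadIso_tri k ω, novOperadIso_tri' k ω⟩⟩,
    ⟨novHom k Ω, isNovInduced_novHom k Ω⟩, fun _ hΦ => hΦ.ker_inf_quadraticPart⟩
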